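/- Let $\chi,\varphi:\mathbb{R}\to[0,1]$ be smooth functions with $\operatorname{Supp}\chi\subset\{|\xi|\le \tfrac43\}$ and $\operatorname{Supp}\varphi\subset\{\tfrac34\le|\xi|\le\tfrac83\}$ such that $\chi(\xi)+\sum_{j\ge 0}\varphi(2^{-j}\xi)=1$ for all $\xi\in\mathbb{R}$, $\sum_{j\in\mathbb{Z}}\varphi(2^{-j}\xi)=1$ for all $\xi\neq 0$, $\operatorname{Supp}\varphi(2^{-j}\cdot)\cap\operatorname{Supp}\varphi(2^{-k}\cdot)=\emptyset$ if $|j-k|\ge 2$, and $\operatorname{Supp}\chi\cap\operatorname{Supp}\varphi(2^{-j}\cdot)=\emptyset$ if $j\ge 1$. For a (complex-valued) tempered distribution $u\in\mathcal{S}'(\mathbb{R})$, put $\Delta_ju=0$ for $j\le -2$, $\Delta_{-1}u=\mathcal{F}^{-1}(\chi\,\mathcal{F}u)$ and $\Delta_ju=\mathcal{F}^{-1}(\varphi(2^{-j}\cdot)\,\mathcal{F}u)$ for $j\ge 0$, where $\mathcal{F}$ is the Fourier transform $\mathcal{F}f(\xi)=\int_{\mathbb{R}}e^{-2\pi i x\xi}f(x)\,dx$.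 For $\sigma\in\mathbb{R}$ and $1\le p,r\le\infty$ let $\|u\|_{B^{\sigma}_{p,r}}=\big\|(2^{j\sigma}\|\Delta_ju\|_{L^p})_{j}\big\|_{\ell^r(\mathbb{Z})}\in[0,\infty]$, and let $B^{\sigma}_{p,r}=B^{\sigma}_{p,r}(\mathbb{R})$ be the space of all $u\in\mathcal{S}'(\mathbb{R})$ for which this is finite. The product of two tempered distributions is $uv=\sum_{(j',j)\in\mathbb{Z}^2}\Delta_{j'}u\,\Delta_jv$, defined whenever this double series converges unconditionally in $\mathcal{S}'(\mathbb{R})$ (each term is a product of two smooth functions of polynomial growth). **Lemma 3.2.** Let $1\le p,r\le\infty$ and $s\in\mathbb{R}$ satisfy either $s>\max\{2,\tfrac1p+\tfrac32\}$, or $s=2$, $2\le p\le\infty$ and $1\le r\le 2$. Then there is a constant $C$ (depending only on $s,p,r$ and the choice of $\chi,\varphi$) such that for all $u,v\in B^{s-2}_{p,r}$ the product $uv$ exists in $\mathcal{S}'(\mathbb{R})$ and $$\|uv\|_{B^{s-3}_{p,r}}\le C\,\|u\|_{B^{s-2}_{p,r}}\,\|v\|_{B^{s-2}_{p,r}}.$$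 -/

import Mathlib

open MeasureTheory
open scoped ENNReal NNReal ContDiff SchwartzMap

/-- A pair `(χ, φ)` of cut-off functions on the line generating a nonhomogeneous
Littlewood-Paley decomposition: smooth, valued in `[0, 1]`, supported in the ball `|ξ| ≤ 4/3` and
in the annulus `3/4 ≤ |ξ| ≤ 8/3` respectively, and generating dyadic partitions of unity. -/
structure IsLittlewoodPaleyPair (χ φ : ℝ → ℝ) : Prop where
  contDiff_low : ContDiff ℝ ∞ χ
  contDiff_high : ContDiff ℝ ∞ φ
  low_mem : ∀ ξ, χ ξ ∈ Set.Icc (0 : ℝ) 1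
  high_mem : ∀ ξ, φ ξ ∈ Set.Icc (0 : ℝ) 1
  tsupport_low : tsupport χ ⊆ {ξ | |ξ| ≤ 4 / 3}
  tsupport_high : tsupport φ ⊆ {ξ | 3 / 4 ≤ |ξ| ∧ |ξ| ≤ 8 / 3}
  partition_nonhomogeneous : ∀ ξ : ℝ, HasSum (fun j : ℕ => φ ((2 : ℝ) ^ (-(j : ℤ)) * ξ)) (1 - χ ξ)
  partition_homogeneous : ∀ ξ : ℝ, ξ ≠ 0 → HasSum (fun j : ℤ => φ ((2 : ℝ) ^ (-j) * ξ)) 1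
  disjoint_high : ∀ j k : ℤ, 2 ≤ |j - k| →
    Disjoint (tsupport fun ξ : ℝ => φ ((2 : ℝ) ^ (-j) * ξ))
      (tsupport fun ξ : ℝ => φ ((2 : ℝ) ^ (-k) * ξ))
  disjoint_low : ∀ j : ℤ, 1 ≤ j →
    Disjoint (tsupport χ) (tsupport fun ξ : ℝ => φ ((2 : ℝ) ^ (-j) * ξ))

/-- The symbol of the `j`-th nonhomogeneous dyadic block. -/
noncomputable def dyadicSymbol (χ φ : ℝ → ℝ) (j : ℤ) (ξ : ℝ) : ℂ :=
  if j ≤ -2 then 0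
  else if j = -1 then (χ ξ : ℂ)
  else (φ ((2 : ℝ) ^ (-j) * ξ) : ℂ)

/-- The nonhomogeneous dyadic block `Δ_j u = 𝓕⁻¹ (symbol · 𝓕 u)` of a tempered distribution. -/
noncomputable def dyadicBlock (χ φ : ℝ → ℝ) (j : ℤ) (u : 𝓢'(ℝ, ℂ)) : 𝓢'(ℝ, ℂ) :=
  TemperedDistribution.fourierMultiplierCLM ℂ (dyadicSymbol χ φ j) u

/-- The `L^p` norm of a tempered distribution: the norm of the `L^p` function that represents it,
and `∞` if it is not given by an `L^p` function. -/
noncomputable def distLpNorm (p : ℝ≥0∞) [Fact (1 ≤ p)] (u : 𝓢'(ℝ, ℂ)) : ℝ≥0∞ :=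
  ⨅ (f : Lp ℂ p (volume : Measure ℝ)) (_ : Lp.toTemperedDistribution f = u), ‖f‖ₑ

/-- The nonhomogeneous Besov norm: the `ℓ^r(ℤ)` norm of `(2^{js} ‖Δ_j u‖_{L^p})_j`, with values
in `[0, ∞]`. -/
noncomputable def besovNorm (χ φ : ℝ → ℝ) (s : ℝ) (p r : ℝ≥0∞) [Fact (1 ≤ p)]
    (u : 𝓢'(ℝ, ℂ)) : ℝ≥0∞ :=
  eLpNorm (fun j : ℤ => (2 : ℝ≥0∞) ^ ((j : ℝ) * s) * distLpNorm p (dyadicBlock χ φ j u)) r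
    Measure.count

/-- Membership in the nonhomogeneous Besov space `B^s_{p,r}(ℝ)`. -/
def MemBesov (χ φ : ℝ → ℝ) (s : ℝ) (p r : ℝ≥0∞) [Fact (1 ≤ p)] (u : 𝓢'(ℝ, ℂ)) : Prop :=
  besovNorm χ φ s p r u < ⊤

/-- `P` is the product of `S` and `T`, where `S` is (given by) a smooth function `f` all of whose
derivatives have at most polynomial growth: `⟨P, g⟩ = ⟨T, f g⟩` for every Schwartz function `g`.
The function `f` is determined by `S`, hence `P` is determined by `S` and `T`. -/
def IsSmoothProduct (S T P : 𝓢'(ℝ, ℂ)) : Prop :=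
  ∃ (f : ℝ → ℂ) (hf : f.HasTemperateGrowth),
    S = Function.HasTemperateGrowth.toTemperedDistribution volume hf ∧
    P = TemperedDistribution.smulLeftCLM ℂ f T

/-- `w` is the product `uv = ∑_{j', j} Δ_{j'} u Δ_j v` of two tempered distributions: each block
`Δ_{j'} u` is a smooth function of polynomial growth that multiplies `Δ_j v`, and the double
series of these products converges unconditionally to `w` in the space of tempered distributions
(that is, tested against each Schwartz function). -/
def IsDistProduct (χ φ : ℝ → ℝ) (u v w : 𝓢'(ℝ, ℂ)) : Prop :=
  ∃ P : ℤ × ℤ → 𝓢'(ℝ, ℂ),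
    (∀ i j : ℤ, IsSmoothProduct (dyadicBlock χ φ i u) (dyadicBlock χ φ j v) (P (i, j))) ∧
    HasSum P w

/-
Let `q = max p 2`. The Bernstein inequality embeds `B^{s-2}_{p,r}` in `B^θ_{q,2}` for some `θ ≥ 0`,
at the cost of `1/p - 1/q` derivatives. There the products `Δ_i u Δ_j v` are estimated by Hölder's
inequality in `L^{q/2}`. Those with `|i - j| ≥ 3` have their spectrum in an annulus of size
`2 ^ max i j`, which makes their sum converge in the sense of distributions; those near the
diagonal are summed by the Cauchy-Schwarz inequality in `ℓ²`, for which `θ = 0` suffices. The sum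
lies in `B^{θ-ε}_{q/2,∞}`, and a second Bernstein embedding from `L^{q/2}` to `L^p` costs
`2/q - 1/p` derivatives. The total loss `1/q ≤ 1/2` is less than the derivative the theorem gives
up.
-/

open ContinuousLinearMap (lsmul)
open scoped FourierTransform Convolution

universe u

section Convolution

section

variable {E F : Type*} [NormedAddCommGroup E] [NormedAddCommGroup F] [NormedSpace ℝ F]

theorem exists_one_add_norm_pow_mul_norm_sub_le [NormedSpace ℝ E] (K : 𝓢(E, F)) (k : ℕ) :
    ∃ C : ℝ, 0 ≤ C ∧ ∀ x y : E, (1 + ‖x‖) ^ k * ‖K (y - x)‖ ≤ C * (1 + ‖y‖) ^ k := by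
  refine ⟨2 ^ k * (Finset.Iic (k, 0)).sup (fun m => SchwartzMap.seminorm ℝ m.1 m.2) K,
    by positivity, fun x y => ?_⟩
  have hK := SchwartzMap.one_add_le_sup_seminorm_apply (𝕜 := ℝ) (m := (k, 0)) (le_refl k)
    (le_refl 0) K (y - x)
  rw [norm_iteratedFDeriv_zero] at hK
  have hxy : 1 + ‖x‖ ≤ (1 + ‖y‖) * (1 + ‖y - x‖) := by
    nlinarith [mul_nonneg (norm_nonneg y) (norm_nonneg (y - x)), norm_le_insert y x]
  calc (1 + ‖x‖) ^ k * ‖K (y - x)‖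
      ≤ ((1 + ‖y‖) * (1 + ‖y - x‖)) ^ k * ‖K (y - x)‖ := by gcongr
    _ = ((1 + ‖y - x‖) ^ k * ‖K (y - x)‖) * (1 + ‖y‖) ^ k := by rw [mul_pow]; ring
    _ ≤ _ := by gcongr

theorem exists_integrable_one_add_norm_pow_inv_smul [MeasurableSpace E] [OpensMeasurableSpace E]
    {μ : Measure E} [hμ : μ.HasTemperateGrowth] {a : ℝ≥0∞} (ha : 1 ≤ a) {f : E → F}
    (hf : MemLp f a μ) : ∃ k : ℕ, Integrable (fun x => ((1 + ‖x‖) ^ k)⁻¹ • f x) μ := by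
  have := ENNReal.HolderConjugate.inv_one_sub_inv' ha
  obtain ⟨k, hk⟩ := hμ.exists_eLpNorm_lt_top ((1 - a⁻¹)⁻¹)
  have hw : MemLp (fun x : E => (1 + ‖x‖) ^ (-k : ℝ)) ((1 - a⁻¹)⁻¹) μ :=
    ⟨(Continuous.rpow_const (by fun_prop) fun x => .inl (by positivity)).aestronglyMeasurable, hk⟩
  refine ⟨k, (memLp_one_iff_integrable.1 (hf.smul hw)).congr (.of_forall fun x => ?_)⟩
  simp [Real.rpow_neg, add_nonneg]

theorem aestronglyMeasurable_of_integrable_one_add_norm_pow_inv_smul [MeasurableSpace E]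
    [OpensMeasurableSpace E] {μ : Measure E} {f : E → F} {k : ℕ}
    (hf : Integrable (fun x => ((1 + ‖x‖) ^ k)⁻¹ • f x) μ) : AEStronglyMeasurable f μ := by
  have hw : AEStronglyMeasurable (fun x : E => (1 + ‖x‖) ^ k) μ :=
    Continuous.aestronglyMeasurable (by fun_prop)
  exact (hw.smul hf.aestronglyMeasurable).congr
    (.of_forall fun x => smul_inv_smul₀ (by positivity) (f x))

theorem norm_smul_schwartzMap_sub_le [NormedSpace ℝ E] [NormedSpace ℂ F]
    {f : E → ℂ} {k : ℕ} {K : 𝓢(E, F)} {C : ℝ} {x y : E}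
    (hC : (1 + ‖x‖) ^ k * ‖K (y - x)‖ ≤ C) :
    ‖f x • K (y - x)‖ ≤ C * ‖((1 + ‖x‖) ^ k)⁻¹ • f x‖ := by
  have hx : 0 < (1 + ‖x‖) ^ k := by positivity
  rw [norm_smul, norm_smul, norm_inv, Real.norm_of_nonneg hx.le]
  calc ‖f x‖ * ‖K (y - x)‖
      = ((1 + ‖x‖) ^ k * ‖K (y - x)‖) * (((1 + ‖x‖) ^ k)⁻¹ * ‖f x‖) := by field_simp
    _ ≤ _ := by gcongr

end

variable {E F : Type*} [NormedAddCommGroup E] [NormedSpace ℝ E] [MeasurableSpace E]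
  {μ : Measure E} [NormedAddCommGroup F] [NormedSpace ℂ F] [NormedSpace ℝ F] {f : E → ℂ} {k : ℕ}

theorem exists_norm_convolution_schwartzMap_le
    (hf : Integrable (fun x => ((1 + ‖x‖) ^ k)⁻¹ • f x) μ) (K : 𝓢(E, F)) :
    ∃ C : ℝ, ∀ y, ‖(f ⋆[lsmul ℂ ℂ, μ] K) y‖ ≤ C * (1 + ‖y‖) ^ k := by
  obtain ⟨C, -, hC⟩ := exists_one_add_norm_pow_mul_norm_sub_le K k
  refine ⟨C * ∫ x, ‖((1 + ‖x‖) ^ k)⁻¹ • f x‖ ∂μ, fun y => ?_⟩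
  calc ‖(f ⋆[lsmul ℂ ℂ, μ] K) y‖
      ≤ ∫ x, C * (1 + ‖y‖) ^ k * ‖((1 + ‖x‖) ^ k)⁻¹ • f x‖ ∂μ :=
        norm_integral_le_of_norm_le (hf.norm.const_mul _)
          (.of_forall fun x => norm_smul_schwartzMap_sub_le (hC x y))
    _ = _ := by rw [integral_const_mul]; ring

variable [BorelSpace E] [SecondCountableTopology E]

theorem convolutionExists_schwartzMap
    (hf : Integrable (fun x => ((1 + ‖x‖) ^ k)⁻¹ • f x) μ) (K : 𝓢(E, F)) :
    ConvolutionExists f K (lsmul ℂ ℂ) μ := by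
  intro y
  obtain ⟨C, -, hC⟩ := exists_one_add_norm_pow_mul_norm_sub_le K k
  exact (hf.norm.const_mul (C * (1 + ‖y‖) ^ k)).mono'
    ((aestronglyMeasurable_of_integrable_one_add_norm_pow_inv_smul hf).smul
      (K.continuous.comp (continuous_const.sub continuous_id)).aestronglyMeasurable)
    (.of_forall fun x => norm_smul_schwartzMap_sub_le (hC x y))

variable [SMulCommClass ℝ ℂ F]

theorem hasFDerivAt_convolution_schwartzMap
    (hf : Integrable (fun x => ((1 + ‖x‖) ^ k)⁻¹ • f x) μ) (K : 𝓢(E, F)) (y : E) :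
    HasFDerivAt (f ⋆[lsmul ℂ ℂ, μ] K)
      ((f ⋆[lsmul ℂ ℂ, μ] (SchwartzMap.fderivCLM ℂ E F K)) y) y := by
  obtain ⟨C, hC, hb⟩ := exists_one_add_norm_pow_mul_norm_sub_le (SchwartzMap.fderivCLM ℂ E F K) k
  refine hasFDerivAt_integral_of_dominated_of_fderiv_le
    (bound := fun x => C * (2 + ‖y‖) ^ k * ‖((1 + ‖x‖) ^ k)⁻¹ • f x‖)
    (Metric.ball_mem_nhds y one_pos)
    (.of_forall fun z => (convolutionExists_schwartzMap hf K z).aestronglyMeasurable)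
    (convolutionExists_schwartzMap hf K y)
    (convolutionExists_schwartzMap hf _ y).aestronglyMeasurable
    (.of_forall fun x z hz => norm_smul_schwartzMap_sub_le ((hb x z).trans ?_))
    (hf.norm.const_mul _) (.of_forall fun x z _ => ?_)
  · have hzy : ‖z‖ < 1 + ‖y‖ := by
      rw [mem_ball_iff_norm] at hz
      linarith [norm_sub_norm_le z y]
    gcongr ?_ * ?_ ^ k
    linarith
  · have hK := (K.differentiableAt (x := z - x)).hasFDerivAt.comp z
      ((hasFDerivAt_id z).sub_const x)
    exact hK.const_smul (f x)

-- The induction on the order of differentiation replaces `F` by `E →L[ℝ] F`, so both spaces have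
-- to live in one universe.
theorem hasTemperateGrowth_convolution_schwartzMap {E F : Type u} [NormedAddCommGroup E]
    [NormedSpace ℝ E] [MeasurableSpace E] [BorelSpace E] [SecondCountableTopology E]
    {μ : Measure E} [NormedAddCommGroup F] [NormedSpace ℂ F] [NormedSpace ℝ F]
    [SMulCommClass ℝ ℂ F] {f : E → ℂ} {k : ℕ}
    (hf : Integrable (fun x => ((1 + ‖x‖) ^ k)⁻¹ • f x) μ) (K : 𝓢(E, F)) :
    (f ⋆[lsmul ℂ ℂ, μ] K).HasTemperateGrowth := by
  refine ⟨contDiff_infty.2 fun n => ?_, fun n => ⟨k, ?_⟩⟩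
  · induction n generalizing F with
    | zero => exact contDiff_zero.2 (continuous_iff_continuousAt.2 fun y =>
        (hasFDerivAt_convolution_schwartzMap hf K y).continuousAt)
    | succ n ih =>
      push_cast
      refine contDiff_succ_iff_hasFDerivAt.2 ?_
      exact ⟨_, ih (SchwartzMap.fderivCLM ℂ E F K), hasFDerivAt_convolution_schwartzMap hf K⟩
  · induction n generalizing F with
    | zero => simpa using exists_norm_convolution_schwartzMap_le hf K
    | succ n ih =>
      have hfderiv : fderiv ℝ (f ⋆[lsmul ℂ ℂ, μ] K) =
          f ⋆[lsmul ℂ ℂ, μ] (SchwartzMap.fderivCLM ℂ E F K) :=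
        funext fun y => (hasFDerivAt_convolution_schwartzMap hf K y).fderiv
      simpa only [← norm_iteratedFDeriv_fderiv, hfderiv] using ih (SchwartzMap.fderivCLM ℂ E F K)

section Multiplier

variable {E : Type*} [NormedAddCommGroup E] [InnerProductSpace ℝ E] [FiniteDimensional ℝ E]
  [MeasurableSpace E] [BorelSpace E]

theorem fourier_smulLeftCLM_fourierInv_apply (K g : 𝓢(E, ℂ)) (x : E) :
    𝓕 (SchwartzMap.smulLeftCLM ℂ (𝓕 K : 𝓢(E, ℂ)) (𝓕⁻ g)) x = ∫ y, g y * K (y - x) := by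
  set G : 𝓢(E, ℂ) := SchwartzMap.compCLMOfContinuousLinearEquiv ℂ (.neg ℝ) g with hG
  have hpair : SchwartzMap.smulLeftCLM ℂ (𝓕 K : 𝓢(E, ℂ)) (𝓕⁻ g) =
      SchwartzMap.pairing (ContinuousLinearMap.mul ℂ ℂ) (𝓕 K) (𝓕 G) := by
    ext ξ
    rw [SchwartzMap.smulLeftCLM_apply_apply (SchwartzMap.hasTemperateGrowth _),
      SchwartzMap.pairing_apply_apply, SchwartzMap.fourierInv_coe,
      Real.fourierInv_eq_fourier_comp_neg]
    rfl
  have hneg : 𝓕 (SchwartzMap.smulLeftCLM ℂ (𝓕 K : 𝓢(E, ℂ)) (𝓕⁻ g)) x =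
      (𝓕⁻ (SchwartzMap.pairing (ContinuousLinearMap.mul ℂ ℂ) (𝓕 K) (𝓕 G)) : 𝓢(E, ℂ)) (-x) := by
    rw [hpair, SchwartzMap.fourierInv_coe, SchwartzMap.fourier_coe,
      Real.fourierInv_eq_fourier_neg, neg_neg]
  rw [hneg, ← SchwartzMap.fourier_convolution, FourierTransform.fourierInv_fourier_eq,
    SchwartzMap.convolution_apply, convolution_def, ← integral_sub_right_eq_self _ x]
  simp [hG, mul_comm]

theorem integrable_one_add_norm_pow_mul_norm (g : 𝓢(E, ℂ)) (k : ℕ) :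
    Integrable fun x => (1 + ‖x‖) ^ k * ‖g x‖ := by
  simp_rw [add_comm (1 : ℝ), add_pow, Finset.sum_mul, one_pow, mul_one,
    mul_right_comm _ _ ‖g _‖]
  exact integrable_finsetSum _ fun m _ => (g.integrable_pow_mul volume m).mul_const _

theorem integrable_prod_mul_schwartzMap_sub {f : E → ℂ} {k : ℕ}
    (hf : Integrable fun x => ((1 + ‖x‖) ^ k)⁻¹ • f x) (g K : 𝓢(E, ℂ)) :
    Integrable fun z : E × E => f z.1 * (g z.2 * K (z.2 - z.1)) := by
  obtain ⟨C, -, hC⟩ := exists_one_add_norm_pow_mul_norm_sub_le K k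
  refine (hf.norm.mul_prod ((integrable_one_add_norm_pow_mul_norm g k).const_mul C)).mono'
    ((aestronglyMeasurable_of_integrable_one_add_norm_pow_inv_smul hf).comp_fst.mul
      (Continuous.aestronglyMeasurable (by fun_prop))) (.of_forall fun ⟨x, y⟩ => ?_)
  calc ‖f x * (g y * K (y - x))‖ = ‖f x • K (y - x)‖ * ‖g y‖ := by
        simp only [norm_mul, norm_smul]; ring
    _ ≤ C * (1 + ‖y‖) ^ k * ‖((1 + ‖x‖) ^ k)⁻¹ • f x‖ * ‖g y‖ := by
        gcongr; exact norm_smul_schwartzMap_sub_le (hC x y)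
    _ = _ := by ring

theorem fourierMultiplierCLM_toTemperedDistribution_apply {a : ℝ≥0∞} [ha : Fact (1 ≤ a)]
    (K g : 𝓢(E, ℂ)) (f : Lp ℂ a (volume : Measure E)) :
    TemperedDistribution.fourierMultiplierCLM ℂ (𝓕 K : 𝓢(E, ℂ)) (Lp.toTemperedDistribution f) g =
      ∫ y, g y • (f ⋆[lsmul ℂ ℂ] K) y := by
  obtain ⟨k, hk⟩ := exists_integrable_one_add_norm_pow_inv_smul ha.out (Lp.memLp f)
  calc _ = ∫ x, ∫ y, f x * (g y * K (y - x)) := by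
        rw [TemperedDistribution.fourierMultiplierCLM_apply_apply, Lp.toTemperedDistribution_apply]
        simp_rw [fourier_smulLeftCLM_fourierInv_apply, integral_const_mul, smul_eq_mul]
        exact integral_congr_ae (.of_forall fun x => mul_comm _ _)
    _ = ∫ y, ∫ x, f x * (g y * K (y - x)) :=
        integral_integral_swap (integrable_prod_mul_schwartzMap_sub hk g K)
    _ = _ := by
        simp_rw [mul_left_comm (f _) (g _), integral_const_mul]
        rfl

end Multiplier

end Convolution

section Young

theorem lintegral_mul_le_rpow_mul_rpow_mul_rpow {X : Type*} [MeasurableSpace X] {μ : Measure X}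
    {f g : X → ℝ≥0∞} (hf : AEMeasurable f μ) (hg : AEMeasurable g μ) {a b c : ℝ} (ha : 0 < a)
    (hc : 0 < c) (hab : a ≤ b) (hcb : c ≤ b) (h : a⁻¹ + c⁻¹ = 1 + b⁻¹) :
    ∫⁻ x, f x * g x ∂μ ≤ (∫⁻ x, f x ^ a * g x ^ c ∂μ) ^ b⁻¹ *
      (∫⁻ x, f x ^ a ∂μ) ^ (a⁻¹ - b⁻¹) * (∫⁻ x, g x ^ c ∂μ) ^ (c⁻¹ - b⁻¹) := by
  have hb : 0 < b := ha.trans_le hab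
  have hb' : 0 ≤ b⁻¹ := by positivity
  have hab' : 0 ≤ a⁻¹ - b⁻¹ := sub_nonneg.2 (inv_anti₀ ha hab)
  have hcb' : 0 ≤ c⁻¹ - b⁻¹ := sub_nonneg.2 (inv_anti₀ hc hcb)
  have hsplit : ∀ {t : ℝ≥0∞} {e : ℝ}, 0 < e → 0 ≤ e⁻¹ - b⁻¹ →
      (t ^ e) ^ b⁻¹ * (t ^ e) ^ (e⁻¹ - b⁻¹) = t := fun he h0 => by
    rw [← ENNReal.rpow_add_of_nonneg _ _ hb' h0, add_sub_cancel, ENNReal.rpow_rpow_inv he.ne']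
  have key := ENNReal.lintegral_prod_norm_pow_le (μ := μ) Finset.univ
    (f := ![fun x => f x ^ a * g x ^ c, fun x => f x ^ a, fun x => g x ^ c])
    (p := ![b⁻¹, a⁻¹ - b⁻¹, c⁻¹ - b⁻¹])
    (fun i _ => by
      fin_cases i
      exacts [(hf.pow_const a).mul (hg.pow_const c), hf.pow_const a, hg.pow_const c])
    (by simp [Fin.sum_univ_three]; linarith)
    (fun i _ => by fin_cases i <;> assumption)
  simp only [Fin.prod_univ_three, Matrix.cons_val] at key
  refine le_of_eq_of_le (lintegral_congr fun x => ?_) key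
  rw [ENNReal.mul_rpow_of_nonneg _ _ hb', mul_assoc (_ * _), mul_mul_mul_comm, hsplit ha hab',
    hsplit hc hcb']

variable {G : Type*} [AddCommGroup G] [MeasurableSpace G] {μ : Measure G}
  {𝕜 V V' W : Type*} [NontriviallyNormedField 𝕜] [NormedAddCommGroup V] [NormedSpace 𝕜 V]
  [NormedAddCommGroup V'] [NormedSpace 𝕜 V'] [NormedAddCommGroup W] [NormedSpace 𝕜 W]
  [NormedSpace ℝ W] (L : V →L[𝕜] V' →L[𝕜] W) {f : G → V} {g : G → V'}

theorem enorm_convolution_le_lintegral (f : G → V) (g : G → V') (y : G) :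
    ‖(f ⋆[L, μ] g) y‖ₑ ≤ ‖L‖ₑ * ∫⁻ x, ‖f x‖ₑ * ‖g (y - x)‖ₑ ∂μ := by
  rw [← lintegral_const_mul' _ _ enorm_ne_top]
  refine (enorm_integral_le_lintegral_enorm _).trans (lintegral_mono fun x => ?_)
  rw [← mul_assoc]
  exact L.le_opENorm₂ _ _

variable [MeasurableAdd₂ G] [MeasurableNeg G] [μ.IsAddLeftInvariant]

theorem aemeasurable_mul_sub [SFinite μ] {f g : G → ℝ≥0∞} (hf : AEMeasurable f μ)
    (hg : AEMeasurable g μ) :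
    AEMeasurable (fun z : G × G => f z.2 * g (z.1 - z.2)) (μ.prod μ) :=
  hf.comp_snd.mul (hg.comp_quasiMeasurePreserving (quasiMeasurePreserving_sub μ μ))

theorem lintegral_lintegral_mul_sub [SFinite μ] {f g : G → ℝ≥0∞}
    (hf : AEMeasurable f μ) (hg : AEMeasurable g μ) :
    ∫⁻ y, ∫⁻ x, f x * g (y - x) ∂μ ∂μ = (∫⁻ x, f x ∂μ) * ∫⁻ x, g x ∂μ := by
  have hg_shift (x : G) : AEMeasurable (fun y => g (y - x)) μ :=
    hg.comp_quasiMeasurePreserving (measurePreserving_sub_right μ x).quasiMeasurePreserving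
  rw [lintegral_lintegral_swap (aemeasurable_mul_sub hf hg)]
  simp_rw [fun x => lintegral_const_mul'' (f x) (hg_shift x), lintegral_sub_right_eq_self g]
  exact lintegral_mul_const'' _ hf

variable [μ.IsNegInvariant]

theorem enorm_convolution_le_of_holderConjugate (hf : AEStronglyMeasurable f μ)
    (hg : AEStronglyMeasurable g μ) (a c : ℝ≥0∞) [a.HolderConjugate c] (y : G) :
    ‖(f ⋆[L, μ] g) y‖ₑ ≤ ‖L‖ₑ * eLpNorm f a μ * eLpNorm g c μ := by
  have hsub := μ.measurePreserving_sub_left y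
  calc ‖(f ⋆[L, μ] g) y‖ₑ ≤ eLpNorm (fun x => L (f x) (g (y - x))) 1 μ := by
        rw [eLpNorm_one_eq_lintegral_enorm]
        exact enorm_integral_le_lintegral_enorm _
    _ ≤ ‖L‖ₑ * eLpNorm f a μ * eLpNorm (g ∘ fun x => y - x) c μ :=
        eLpNorm_le_eLpNorm_mul_eLpNorm_of_nnnorm hf (hg.comp_measurePreserving hsub)
          (fun v w => L v w) ‖L‖₊ (.of_forall fun x => L.le_opNorm₂ _ _)
    _ = _ := by rw [eLpNorm_comp_measurePreserving hg hsub]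

variable [SFinite μ]

theorem lintegral_rpow_lintegral_mul_sub_le {f g : G → ℝ≥0∞} (hf : AEMeasurable f μ)
    (hg : AEMeasurable g μ) {a b c : ℝ} (ha : 0 < a)
    (hc : 0 < c) (hab : a ≤ b) (hcb : c ≤ b) (h : a⁻¹ + c⁻¹ = 1 + b⁻¹) :
    ∫⁻ y, (∫⁻ x, f x * g (y - x) ∂μ) ^ b ∂μ ≤
      (∫⁻ x, f x ^ a ∂μ) ^ (b / a) * (∫⁻ x, g x ^ c ∂μ) ^ (b / c) := by
  have hb : 0 < b := ha.trans_le hab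
  have hfa := hf.pow_const a
  have hgc := hg.pow_const c
  set A := ∫⁻ x, f x ^ a ∂μ
  set D := ∫⁻ x, g x ^ c ∂μ
  have hg_sub : ∀ y, AEMeasurable (fun x => g (y - x)) μ := fun y =>
    hg.comp_quasiMeasurePreserving (quasiMeasurePreserving_sub_left μ y)
  have hpt : ∀ y, (∫⁻ x, f x * g (y - x) ∂μ) ^ b ≤
      (∫⁻ x, f x ^ a * g (y - x) ^ c ∂μ) * (A ^ (b / a - 1) * D ^ (b / c - 1)) := fun y => by
    have hHolder := ENNReal.rpow_le_rpow
      (lintegral_mul_le_rpow_mul_rpow_mul_rpow hf (hg_sub y) ha hc hab hcb h) hb.le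
    rw [lintegral_sub_left_eq_self (fun x => g x ^ c) y,
      ENNReal.mul_rpow_of_nonneg _ _ hb.le, ENNReal.mul_rpow_of_nonneg _ _ hb.le,
      ENNReal.rpow_inv_rpow hb.ne', ← ENNReal.rpow_mul, ← ENNReal.rpow_mul, mul_assoc] at hHolder
    convert hHolder using 4 <;> field_simp
  calc _ ≤ ∫⁻ y, (∫⁻ x, f x ^ a * g (y - x) ^ c ∂μ) * (A ^ (b / a - 1) * D ^ (b / c - 1)) ∂μ :=
        lintegral_mono hpt
    _ = A * D * (A ^ (b / a - 1) * D ^ (b / c - 1)) := by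
        rw [lintegral_mul_const'' _ (aemeasurable_mul_sub hfa hgc).lintegral_prod_right',
          lintegral_lintegral_mul_sub hfa hgc]
    _ = _ := by
        rw [mul_mul_mul_comm]
        have hpow : ∀ {t : ℝ≥0∞} {e : ℝ}, 0 < e → e ≤ b → t * t ^ (b / e - 1) = t ^ (b / e) :=
          fun {t e} he heb => by
            nth_rw 1 [← ENNReal.rpow_one t]
            rw [← ENNReal.rpow_add_of_nonneg _ _ zero_le_one
              (sub_nonneg.2 ((one_le_div he).2 heb)), add_sub_cancel]
        rw [hpow ha hab, hpow hc hcb]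

theorem eLpNorm_convolution_le_of_nnreal (hf : AEStronglyMeasurable f μ)
    (hg : AEStronglyMeasurable g μ) {a b c : ℝ≥0} (ha : a ≠ 0) (hc : c ≠ 0) (hab : a ≤ b)
    (hcb : c ≤ b) (h : (a : ℝ)⁻¹ + (c : ℝ)⁻¹ = 1 + (b : ℝ)⁻¹) :
    eLpNorm (f ⋆[L, μ] g) b μ ≤ ‖L‖ₑ * eLpNorm f a μ * eLpNorm g c μ := by
  have hb : b ≠ 0 := ((pos_iff_ne_zero.2 ha).trans_le hab).ne'
  have hb' : (0 : ℝ) < b := by positivity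
  have hYoung := lintegral_rpow_lintegral_mul_sub_le hf.enorm hg.enorm (a := a) (b := b) (c := c)
    (by positivity) (by positivity) hab hcb h
  rw [eLpNorm_nnreal_eq_lintegral hb, eLpNorm_nnreal_eq_lintegral ha,
    eLpNorm_nnreal_eq_lintegral hc, one_div, one_div, one_div, ENNReal.rpow_inv_le_iff hb']
  calc ∫⁻ y, ‖(f ⋆[L, μ] g) y‖ₑ ^ (b : ℝ) ∂μ
      ≤ ∫⁻ y, ‖L‖ₑ ^ (b : ℝ) * (∫⁻ x, ‖f x‖ₑ * ‖g (y - x)‖ₑ ∂μ) ^ (b : ℝ) ∂μ := by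
        refine lintegral_mono fun y => ?_
        rw [← ENNReal.mul_rpow_of_nonneg _ _ hb'.le]
        gcongr
        exact enorm_convolution_le_lintegral L f g y
    _ ≤ ‖L‖ₑ ^ (b : ℝ) * ((∫⁻ x, ‖f x‖ₑ ^ (a : ℝ) ∂μ) ^ ((b : ℝ) / a) *
          (∫⁻ x, ‖g x‖ₑ ^ (c : ℝ) ∂μ) ^ ((b : ℝ) / c)) := by
        rw [lintegral_const_mul' _ _ (by finiteness)]
        gcongr
    _ = _ := by
        rw [ENNReal.mul_rpow_of_nonneg _ _ hb'.le, ENNReal.mul_rpow_of_nonneg _ _ hb'.le,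
          ← ENNReal.rpow_mul, ← ENNReal.rpow_mul, mul_assoc, inv_mul_eq_div, inv_mul_eq_div]

theorem le_of_inv_add_inv_eq_one_add_inv {a b c : ℝ≥0∞} (hc : 1 ≤ c)
    (h : a⁻¹ + c⁻¹ = 1 + b⁻¹) : a ≤ b := by
  rw [← ENNReal.inv_le_inv, ← ENNReal.add_le_add_iff_left ENNReal.one_ne_top, ← h, add_comm]
  gcongr
  exact ENNReal.inv_le_one.2 hc

theorem eLpNorm_convolution_le (hf : AEStronglyMeasurable f μ) (hg : AEStronglyMeasurable g μ)
    {a b c : ℝ≥0∞} (ha : 1 ≤ a) (hc : 1 ≤ c) (h : a⁻¹ + c⁻¹ = 1 + b⁻¹) :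
    eLpNorm (f ⋆[L, μ] g) b μ ≤ ‖L‖ₑ * eLpNorm f a μ * eLpNorm g c μ := by
  rcases eq_or_ne b ⊤ with rfl | hb
  · have : a.HolderConjugate c := ⟨by simpa using h⟩
    rw [eLpNorm_exponent_top]
    exact essSup_le_of_ae_le _ (.of_forall (enorm_convolution_le_of_holderConjugate L hf hg a c))
  have hab : a ≤ b := le_of_inv_add_inv_eq_one_add_inv hc h
  have hcb : c ≤ b := le_of_inv_add_inv_eq_one_add_inv ha (add_comm a⁻¹ c⁻¹ ▸ h)
  have ha0 : a ≠ 0 := (zero_lt_one.trans_le ha).ne'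
  have hc0 : c ≠ 0 := (zero_lt_one.trans_le hc).ne'
  lift b to ℝ≥0 using hb
  lift a to ℝ≥0 using ne_top_of_le_ne_top ENNReal.coe_ne_top hab
  lift c to ℝ≥0 using ne_top_of_le_ne_top ENNReal.coe_ne_top hcb
  norm_cast at ha0 hc0 hab hcb
  have hb0 : b ≠ 0 := ((pos_iff_ne_zero.2 ha0).trans_le hab).ne'
  rw [← ENNReal.coe_inv ha0, ← ENNReal.coe_inv hc0, ← ENNReal.coe_inv hb0] at h
  exact eLpNorm_convolution_le_of_nnreal L hf hg ha0 hc0 hab hcb (by exact_mod_cast h)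

theorem eLpNorm_comp_smul {E F : Type*} [NormedAddCommGroup E] [NormedSpace ℝ E]
    [FiniteDimensional ℝ E] [MeasurableSpace E] [BorelSpace E] [NormedAddCommGroup F]
    (μ : Measure E) [μ.IsAddHaarMeasure] (f : E → F) {l : ℝ} (hl : 0 < l) (c : ℝ≥0∞) :
    eLpNorm (fun x => f (l • x)) c μ =
      ENNReal.ofReal l ^ (-(Module.finrank ℝ E * c⁻¹.toReal)) * eLpNorm f c μ := by
  have hemb : MeasurableEmbedding fun x : E => l • x :=
    (Homeomorph.smulOfNeZero l hl.ne').measurableEmbedding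
  have hmap := hemb.eLpNorm_map_measure (g := f) (p := c) (μ := μ)
  rw [Measure.map_addHaar_smul μ hl.ne', eLpNorm_smul_measure_of_ne_zero (by positivity),
    abs_of_pos (by positivity)] at hmap
  rw [← Function.comp_def, ← hmap, smul_eq_mul, ENNReal.ofReal_inv_of_pos (by positivity),
    ENNReal.ofReal_pow hl.le, ← ENNReal.rpow_natCast, ← ENNReal.rpow_neg, ← ENNReal.rpow_mul,
    neg_mul, one_div, ENNReal.toReal_inv]

variable {E F : Type*} [NormedAddCommGroup E] [InnerProductSpace ℝ E] [FiniteDimensional ℝ E]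
  [MeasurableSpace E] [BorelSpace E]

theorem fourierInv_comp_inv_smul [NormedAddCommGroup F] [NormedSpace ℂ F] (f : E → F) {l : ℝ}
    (hl : 0 < l) (x : E) :
    𝓕⁻ (fun ξ => f (l⁻¹ • ξ)) x = l ^ Module.finrank ℝ E • 𝓕⁻ f (l • x) := by
  have hint := Measure.integral_comp_inv_smul_of_nonneg volume
    (fun ξ => Real.fourierChar (inner ℝ ξ (l • x)) • f ξ) hl.le
  rw [Real.fourierInv_eq, Real.fourierInv_eq, ← hint]
  refine integral_congr_ae (.of_forall fun ξ => ?_)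
  simp only
  rw [real_inner_smul_left, real_inner_smul_right, inv_mul_cancel_left₀ hl.ne']

theorem exists_schwartzMap_fourier_eq_comp_inv_smul (M : 𝓢(E, ℂ)) {l : ℝ} (hl : 0 < l) :
    ∃ K : 𝓢(E, ℂ), (⇑(𝓕 K : 𝓢(E, ℂ)) = fun ξ => M (l⁻¹ • ξ)) ∧ ∀ c : ℝ≥0∞,
      eLpNorm K c = ENNReal.ofReal l ^ (Module.finrank ℝ E * (1 - c⁻¹.toReal)) *
        eLpNorm (𝓕⁻ M : 𝓢(E, ℂ)) c := by
  let e : E ≃L[ℝ] E := ContinuousLinearEquiv.smulLeft (Units.mk0 l⁻¹ (inv_ne_zero hl.ne'))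
  set D := SchwartzMap.compCLMOfContinuousLinearEquiv ℂ e M
  have hDM : ⇑D = fun ξ => M (l⁻¹ • ξ) := rfl
  refine ⟨𝓕⁻ D, by simp [hDM], fun c => ?_⟩
  have hK : ⇑(𝓕⁻ D : 𝓢(E, ℂ)) = (l ^ Module.finrank ℝ E) • fun x => (𝓕⁻ M : 𝓢(E, ℂ)) (l • x) := by
    ext x
    rw [SchwartzMap.fourierInv_coe, hDM, fourierInv_comp_inv_smul _ hl, SchwartzMap.fourierInv_coe]
    rfl
  have hl0 : ENNReal.ofReal l ≠ 0 := by simpa using hl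
  rw [hK, eLpNorm_const_smul, eLpNorm_comp_smul volume _ hl, ← mul_assoc,
    Real.enorm_of_nonneg (by positivity), ENNReal.ofReal_pow hl.le, ← ENNReal.rpow_natCast,
    ← ENNReal.rpow_add _ _ hl0 ENNReal.ofReal_ne_top]
  congr 2
  ring

end Young

section Spectrum

open scoped Pointwise
open TemperedDistribution (fourierMultiplierCLM)

/-- The tempered distribution `u` has its spectrum in `s`: its Fourier transform annihilates every
Schwartz function that vanishes on `s`. The test functions have to vanish at the points of `s`
only, not in a neighbourhood of it, so this is more than `supp 𝓕 u ⊆ s`; it holds for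
`u = 𝓕⁻¹ (m 𝓕 v)` when the smooth symbol `m` vanishes off `s`. -/
def HasSpectrumIn {E : Type*} [NormedAddCommGroup E] [InnerProductSpace ℝ E]
    [FiniteDimensional ℝ E] [MeasurableSpace E] [BorelSpace E] (s : Set E) (u : 𝓢'(E, ℂ)) : Prop :=
  ∀ g : 𝓢(E, ℂ), (∀ ξ ∈ s, g ξ = 0) → 𝓕 u g = 0

variable {E : Type*} [NormedAddCommGroup E] [InnerProductSpace ℝ E] [FiniteDimensional ℝ E]
  [MeasurableSpace E] [BorelSpace E] {s t : Set E} {u : 𝓢'(E, ℂ)} {m : E → ℂ}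

theorem hasSpectrumIn_fourierMultiplierCLM (hm : m.HasTemperateGrowth) (hs : ∀ ξ ∉ s, m ξ = 0)
    (u : 𝓢'(E, ℂ)) : HasSpectrumIn s (fourierMultiplierCLM ℂ m u) := by
  intro g hg
  have hmg : SchwartzMap.smulLeftCLM ℂ m g = 0 := by
    ext ξ
    rw [SchwartzMap.smulLeftCLM_apply_apply hm]
    by_cases hξ : ξ ∈ s
    · simp [hg ξ hξ]
    · simp [hs ξ hξ]
  rw [TemperedDistribution.fourier_apply, TemperedDistribution.fourierMultiplierCLM_apply_apply,
    FourierTransform.fourierInv_fourier_eq, hmg]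
  simp

namespace HasSpectrumIn

theorem mono (hu : HasSpectrumIn s u) (hst : s ⊆ t) : HasSpectrumIn t u :=
  fun g hg => hu g fun ξ hξ => hg ξ (hst hξ)

theorem apply_eq_zero (hu : HasSpectrumIn s u) {g : 𝓢(E, ℂ)}
    (hg : ∀ ξ ∈ s, (𝓕⁻ g : 𝓢(E, ℂ)) ξ = 0) : u g = 0 := by
  simpa [TemperedDistribution.fourier_apply] using hu (𝓕⁻ g) hg

theorem fourierMultiplierCLM_eq_smul (hu : HasSpectrumIn s u) (hm : m.HasTemperateGrowth) {c : ℂ}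
    (hs : ∀ ξ ∈ s, m ξ = c) : fourierMultiplierCLM ℂ m u = c • u := by
  ext g
  rw [TemperedDistribution.fourierMultiplierCLM_apply_apply, smul_apply,
    ← map_smul, ← sub_eq_zero, ← map_sub]
  refine hu.apply_eq_zero fun ξ hξ => ?_
  rw [← FourierTransform.fourierInvCLM_apply (R := ℂ), map_sub]
  simp [SchwartzMap.smulLeftCLM_apply_apply hm, hs ξ hξ]

end HasSpectrumIn

theorem fourier_compSubConstCLM_neg_apply (g : 𝓢(E, ℂ)) (η x : E) :
    𝓕 (SchwartzMap.compSubConstCLM ℂ (-η) g) x = Real.fourierChar (inner ℝ x η) • 𝓕 g x := by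
  rw [SchwartzMap.fourier_coe, SchwartzMap.fourier_coe, Real.fourier_eq, Real.fourier_eq,
    Circle.smul_def, ← integral_smul, ← integral_sub_right_eq_self _ η]
  refine integral_congr_ae (.of_forall fun ξ => ?_)
  simp only [SchwartzMap.compSubConstCLM_apply, sub_neg_eq_add, sub_add_cancel, ← Circle.smul_def,
    smul_smul, ← AddChar.map_add_eq_mul, inner_sub_left, real_inner_comm x η]
  congr 2
  ring

theorem HasSpectrumIn.smulLeftCLM {F : E → ℂ} (hF : F.HasTemperateGrowth)
    (hs : HasSpectrumIn s (hF.toTemperedDistribution volume)) (ht : HasSpectrumIn t u) :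
    HasSpectrumIn (s + t) (TemperedDistribution.smulLeftCLM ℂ F u) := by
  intro g hg
  rw [TemperedDistribution.fourier_apply, TemperedDistribution.smulLeftCLM_apply_apply]
  refine ht.apply_eq_zero fun η hη => ?_
  have hshift : ∫ x, 𝓕 (SchwartzMap.compSubConstCLM ℂ (-η) g) x • F x = 0 :=
    hs _ fun ξ hξ => by
      rw [SchwartzMap.compSubConstCLM_apply, sub_neg_eq_add]
      exact hg _ (Set.add_mem_add hξ hη)
  rw [← hshift, SchwartzMap.fourierInv_coe, Real.fourierInv_eq]
  refine integral_congr_ae (.of_forall fun x => ?_)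
  simp only [fourier_compSubConstCLM_neg_apply, SchwartzMap.smulLeftCLM_apply_apply hF, smul_eq_mul,
    Circle.smul_def]
  ring

end Spectrum

section Representation

open TemperedDistribution (fourierMultiplierCLM)

variable {E : Type*} [NormedAddCommGroup E] [InnerProductSpace ℝ E]

theorem exists_hasSum_of_norm_apply_le {ι : Type*} {q : Seminorm ℂ 𝓢(E, ℂ)} (hq : Continuous q)
    {c : ι → ℝ} (hc : Summable c) {P : ι → 𝓢'(E, ℂ)} (hP : ∀ i g, ‖P i g‖ ≤ c i * q g) :
    ∃ w : 𝓢'(E, ℂ), HasSum P w := by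
  have hs : ∀ g, Summable fun i => P i g := fun g =>
    Summable.of_norm_bounded (hc.mul_right _) fun i => hP i g
  let W : 𝓢(E, ℂ) →ₗ[ℂ] ℂ :=
    { toFun := fun g => ∑' i, P i g
      map_add' := fun g g' => by
        simp_rw [map_add]
        exact (hs g).tsum_add (hs g')
      map_smul' := fun a g => by
        simp_rw [map_smul]
        exact (hs g).tsum_const_smul a }
  have hW : ∀ g, ‖W g‖ ≤ (∑' i, c i) * q g := fun g => by
    rw [← tsum_mul_right]
    exact tsum_of_norm_bounded (hc.mul_right _).hasSum fun i => hP i g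
  have hcont : Continuous W := by
    refine continuous_of_continuousAt_zero W ?_
    rw [ContinuousAt, map_zero]
    refine squeeze_zero_norm hW ?_
    simpa using (hq.const_mul (∑' i, c i)).tendsto 0
  refine ⟨ContinuousLinearMap.toPointwiseConvergenceCLM ℂ (RingHom.id ℂ) 𝓢(E, ℂ) ℂ ⟨W, hcont⟩, ?_⟩
  rw [HasSum, PointwiseConvergenceCLM.tendsto_iff_forall_tendsto]
  intro g
  refine (hs g).hasSum.congr' (.of_forall fun s => ?_)
  exact (map_sum (PointwiseConvergenceCLM.evalCLM (RingHom.id ℂ) ℂ g) P s).symm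

theorem hasTemperateGrowth_comp_inv_smul (M : 𝓢(E, ℂ)) (l : ℝ) :
    (fun ξ => M (l⁻¹ • ξ)).HasTemperateGrowth :=
  M.hasTemperateGrowth.comp
    (ContinuousLinearMap.hasTemperateGrowth (l⁻¹ • ContinuousLinearMap.id ℝ E))

theorem exists_schwartzMap_eq_ofReal {m : E → ℝ} (hm : ContDiff ℝ ∞ m)
    (hsupp : HasCompactSupport m) : ∃ M : 𝓢(E, ℂ), ∀ ξ, M ξ = m ξ := by
  have hsupp' : HasCompactSupport fun ξ => (m ξ : ℂ) := hsupp.comp_left Complex.ofReal_zero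
  have hm' : ContDiff ℝ ∞ fun ξ => (m ξ : ℂ) := Complex.ofRealCLM.contDiff.comp hm
  exact ⟨hsupp'.toSchwartzMap hm', fun ξ => rfl⟩

variable [FiniteDimensional ℝ E]

theorem exists_schwartzMap_eq_one_on_closedBall (R : ℝ) :
    ∃ M : 𝓢(E, ℂ), ∀ ξ ∈ Metric.closedBall (0 : E) R, M ξ = 1 := by
  let b : ContDiffBump (0 : E) := ⟨max R 1, max R 1 + 1, by positivity, by simp⟩
  obtain ⟨M, hM⟩ := exists_schwartzMap_eq_ofReal b.contDiff b.hasCompactSupport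
  refine ⟨M, fun ξ hξ => ?_⟩
  rw [hM, b.one_of_mem_closedBall (Metric.closedBall_subset_closedBall (le_max_left _ _) hξ),
    Complex.ofReal_one]

theorem comp_inv_smul_mul_norm_sq_eq {E : Type*} [NormedAddCommGroup E] [NormedSpace ℝ E]
    {M : E → ℂ} {a b l : ℝ} (hM : ∀ ξ, a ≤ ‖ξ‖ → ‖ξ‖ ≤ b → M ξ * (‖ξ‖ ^ 2 : ℝ) = 1) (hl : 0 < l)
    {ξ : E} (ha : a * l ≤ ‖ξ‖) (hb : ‖ξ‖ ≤ b * l) :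
    M (l⁻¹ • ξ) * (‖ξ‖ ^ 2 : ℝ) = (l ^ 2 : ℝ) := by
  have hnorm : ‖l⁻¹ • ξ‖ = l⁻¹ * ‖ξ‖ := by
    rw [norm_smul, norm_inv, Real.norm_of_nonneg hl.le]
  have hscale : ‖ξ‖ ^ 2 = ‖l⁻¹ • ξ‖ ^ 2 * l ^ 2 := by
    rw [hnorm]
    field_simp
  rw [hscale, Complex.ofReal_mul, ← mul_assoc, hM, one_mul]
  · rwa [hnorm, le_inv_mul_iff₀ hl, mul_comm]
  · rwa [hnorm, inv_mul_le_iff₀ hl, mul_comm]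

theorem exists_schwartzMap_mul_norm_sq_eq_one {a : ℝ} (ha : 0 < a) (b : ℝ) :
    ∃ M : 𝓢(E, ℂ), ∀ ξ : E, a ≤ ‖ξ‖ → ‖ξ‖ ≤ b → M ξ * (‖ξ‖ ^ 2 : ℝ) = 1 := by
  let d : ContDiffBump (0 : E) := ⟨max b 1, max b 1 + 1, by positivity, by simp⟩
  let c : ContDiffBump (0 : E) := ⟨a / 2, a, by positivity, by linarith⟩
  have hpos : ∀ ξ : E, 0 < ‖ξ‖ ^ 2 + c ξ := fun ξ => by
    rcases eq_or_ne ξ 0 with rfl | hξ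
    · rw [c.one_of_mem_closedBall (Metric.mem_closedBall_self c.rIn_pos.le)]
      positivity
    · have : 0 ≤ c ξ := c.nonneg
      positivity
  obtain ⟨M, hM⟩ := exists_schwartzMap_eq_ofReal (m := fun ξ => d ξ * (‖ξ‖ ^ 2 + c ξ)⁻¹)
    (d.contDiff.mul (((contDiff_norm_sq ℝ).add c.contDiff).inv fun ξ => (hpos ξ).ne'))
    d.hasCompactSupport.mul_right
  refine ⟨M, fun ξ haξ hξb => ?_⟩
  have hξ : ‖ξ‖ ^ 2 ≠ 0 := by
    have := ha.trans_le haξ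
    positivity
  have hd : d ξ = 1 := d.one_of_mem_closedBall (by simpa [d] using Or.inl hξb)
  have hc : c ξ = 0 := c.zero_of_le_dist (by simpa [c] using haξ)
  rw [hM, hd, hc, add_zero, one_mul, ← Complex.ofReal_mul, inv_mul_cancel₀ hξ, Complex.ofReal_one]

variable [MeasurableSpace E] [BorelSpace E] {p : ℝ≥0∞} [Fact (1 ≤ p)]

theorem toTemperedDistribution_injective :
    Function.Injective (Lp.toTemperedDistribution : Lp ℂ p (volume : Measure E) → 𝓢'(E, ℂ)) :=
  LinearMap.ker_eq_bot.1 (Lp.ker_toTemperedDistributionCLM_eq_bot (F := ℂ)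
    (μ := (volume : Measure E)) (p := p))

theorem toTemperedDistribution_toLp {F : E → ℂ} (hF : F.HasTemperateGrowth) (hp : MemLp F p) :
    Lp.toTemperedDistribution (hp.toLp F) = hF.toTemperedDistribution volume := by
  ext g
  rw [Lp.toTemperedDistribution_apply]
  refine integral_congr_ae ?_
  filter_upwards [hp.coeFn_toLp] with x hx
  rw [hx]
  rfl

variable (p) in
theorem exists_seminorm_toTemperedDistribution_apply_le :
    ∃ q : Seminorm ℂ 𝓢(E, ℂ), Continuous q ∧ ∀ (f : Lp ℂ p (volume : Measure E)) (g : 𝓢(E, ℂ)),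
      ‖Lp.toTemperedDistribution f g‖ ≤ ‖f‖ * q g := by
  have hp : 1 ≤ p := Fact.out
  have : Fact (1 ≤ (1 - p⁻¹)⁻¹) := ⟨ENNReal.one_le_inv.2 tsub_le_self⟩
  have := ENNReal.HolderConjugate.inv_one_sub_inv' hp
  set B := (lsmul ℂ ℂ (E := ℂ)).flip.lpPairing (volume : Measure E) p (1 - p⁻¹)⁻¹
  let T := SchwartzMap.toLpCLM ℂ ℂ (E := E) (1 - p⁻¹)⁻¹ volume
  refine ⟨‖B‖₊ • (normSeminorm ℂ _).comp T.toLinearMap, ?_, fun f g => ?_⟩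
  · exact (continuous_const.mul (continuous_norm.comp T.continuous))
  · calc ‖Lp.toTemperedDistribution f g‖ ≤ ‖B‖ * ‖f‖ * ‖T g‖ := B.le_opNorm₂ f (T g)
      _ = ‖f‖ * (‖B‖ * ‖T g‖) := by ring

open Laplacian in
theorem HasSpectrumIn.laplacian_fourierMultiplierCLM {M : E → ℂ} {s : Set E} {u : 𝓢'(E, ℂ)} {c : ℂ}
    (hu : HasSpectrumIn s u) (hM : M.HasTemperateGrowth)
    (hs : ∀ ξ ∈ s, M ξ * (‖ξ‖ ^ 2 : ℝ) = c) :
    Δ (fourierMultiplierCLM ℂ M u) = (-(2 * Real.pi) ^ 2 * c) • u := by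
  have hN : (fun ξ : E => ((‖ξ‖ ^ 2 : ℝ) : ℂ)).HasTemperateGrowth := by fun_prop
  rw [TemperedDistribution.laplacian_eq_fourierMultiplierCLM,
    TemperedDistribution.fourierMultiplierCLM_fourierMultiplierCLM_apply hM hN,
    hu.fourierMultiplierCLM_eq_smul (hM.mul hN) hs, mul_smul,
    ← Complex.coe_smul]
  push_cast
  rfl

end Representation

section Bernstein

open TemperedDistribution (fourierMultiplierCLM)

variable {E : Type} [NormedAddCommGroup E] [InnerProductSpace ℝ E] [FiniteDimensional ℝ E]
  [MeasurableSpace E] [BorelSpace E] {p : ℝ≥0∞} [Fact (1 ≤ p)]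

theorem exists_bernstein (M : 𝓢(E, ℂ)) (a b : ℝ≥0∞) [ha : Fact (1 ≤ a)] (hab : a ≤ b) :
    ∃ C : ℝ≥0, ∀ l : ℝ, 0 < l → ∀ f : Lp ℂ a (volume : Measure E),
      ∃ (F : E → ℂ) (hF : F.HasTemperateGrowth),
        fourierMultiplierCLM ℂ (fun ξ => M (l⁻¹ • ξ))
          (Lp.toTemperedDistribution f) = hF.toTemperedDistribution volume ∧
        eLpNorm F b ≤ C *
          ENNReal.ofReal l ^ (Module.finrank ℝ E * (a⁻¹.toReal - b⁻¹.toReal)) * ‖f‖ₑ := by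
  have ha_inv : a⁻¹ ≤ 1 := ENNReal.inv_le_one.2 ha.out
  have hb_inv : b⁻¹ ≤ a⁻¹ := ENNReal.inv_le_inv.2 hab
  set c : ℝ≥0∞ := (1 + b⁻¹ - a⁻¹)⁻¹ with hc_def
  have hc : 1 ≤ c := by
    rw [hc_def, ENNReal.one_le_inv, tsub_le_iff_right]
    gcongr
  have hYoung : a⁻¹ + c⁻¹ = 1 + b⁻¹ := by
    rw [hc_def, inv_inv, add_tsub_cancel_of_le (ha_inv.trans le_self_add)]
  have hexp : 1 - c⁻¹.toReal = a⁻¹.toReal - b⁻¹.toReal := by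
    have hreal := congrArg ENNReal.toReal hYoung
    have ha_top : a⁻¹ ≠ ⊤ := ne_top_of_le_ne_top ENNReal.one_ne_top ha_inv
    have hc_top : c⁻¹ ≠ ⊤ := ne_top_of_le_ne_top ENNReal.one_ne_top (ENNReal.inv_le_one.2 hc)
    rw [ENNReal.toReal_add ha_top hc_top, ENNReal.toReal_add ENNReal.one_ne_top
      (ne_top_of_le_ne_top ha_top hb_inv), ENNReal.toReal_one] at hreal
    linarith
  refine ⟨(eLpNorm (𝓕⁻ M : 𝓢(E, ℂ)) c).toNNReal, fun l hl f => ?_⟩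
  obtain ⟨K, hK, hK_norm⟩ := exists_schwartzMap_fourier_eq_comp_inv_smul M hl
  obtain ⟨k, hk⟩ := exists_integrable_one_add_norm_pow_inv_smul ha.out (Lp.memLp f)
  refine ⟨_, hasTemperateGrowth_convolution_schwartzMap hk K, ?_, ?_⟩
  · ext g
    rw [← hK, fourierMultiplierCLM_toTemperedDistribution_apply]
    rfl
  · have hlsmul : ‖(lsmul ℂ ℂ : ℂ →L[ℂ] ℂ →L[ℂ] ℂ)‖ₑ = 1 := by simp
    have hconv := eLpNorm_convolution_le (μ := volume) (lsmul ℂ ℂ : ℂ →L[ℂ] ℂ →L[ℂ] ℂ)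
      (Lp.aestronglyMeasurable f) K.continuous.aestronglyMeasurable ha.out hc hYoung
    rw [hlsmul, one_mul, hK_norm, hexp, ← Lp.enorm_def,
      ← ENNReal.coe_toNNReal (SchwartzMap.memLp (𝓕⁻ M : 𝓢(E, ℂ)) c volume).eLpNorm_ne_top, mul_comm,
      mul_comm (_ ^ _)] at hconv
    exact hconv

theorem exists_bernstein_of_hasSpectrumIn (R : ℝ) (a b : ℝ≥0∞) [Fact (1 ≤ a)] (hab : a ≤ b) :
    ∃ C : ℝ≥0, ∀ l : ℝ, 0 < l → ∀ f : Lp ℂ a (volume : Measure E),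
      HasSpectrumIn (Metric.closedBall 0 (R * l)) (Lp.toTemperedDistribution f) →
      ∃ (F : E → ℂ) (hF : F.HasTemperateGrowth),
        Lp.toTemperedDistribution f = hF.toTemperedDistribution volume ∧
        eLpNorm F b ≤ C *
          ENNReal.ofReal l ^ (Module.finrank ℝ E * (a⁻¹.toReal - b⁻¹.toReal)) * ‖f‖ₑ := by
  obtain ⟨M, hM⟩ := exists_schwartzMap_eq_one_on_closedBall (E := E) R
  obtain ⟨C, hC⟩ := exists_bernstein M a b hab
  refine ⟨C, fun l hl f hf => ?_⟩
  obtain ⟨F, hF, hfF, hF_norm⟩ := hC l hl f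
  refine ⟨F, hF, ?_, hF_norm⟩
  rw [← hfF, hf.fourierMultiplierCLM_eq_smul (hasTemperateGrowth_comp_inv_smul M l) fun ξ hξ => ?_,
    one_smul]
  refine hM _ (mem_closedBall_zero_iff.2 ?_)
  rw [norm_smul, norm_inv, Real.norm_of_nonneg hl.le, inv_mul_le_iff₀ hl, mul_comm]
  exact mem_closedBall_zero_iff.1 hξ

variable (p) in
open Laplacian in
theorem exists_laplacian_eq_of_hasSpectrumIn_annulus {a : ℝ} (ha : 0 < a) (b : ℝ) :
    ∃ C : ℝ≥0, ∀ l : ℝ, 0 < l → ∀ f : Lp ℂ p (volume : Measure E),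
      HasSpectrumIn {ξ | a * l ≤ ‖ξ‖ ∧ ‖ξ‖ ≤ b * l} (Lp.toTemperedDistribution f) →
      ∃ h : Lp ℂ p (volume : Measure E),
        Lp.toTemperedDistribution f = Δ (Lp.toTemperedDistribution h) ∧
        ‖h‖ ≤ C * (l ^ 2)⁻¹ * ‖f‖ := by
  obtain ⟨M, hM⟩ := exists_schwartzMap_mul_norm_sq_eq_one (E := E) ha b
  obtain ⟨C, hC⟩ := exists_bernstein M p p le_rfl
  refine ⟨C, fun l hl f hf => ?_⟩
  obtain ⟨F, hF, hfF, hF_norm⟩ := hC l hl f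
  have hF_le : eLpNorm F p ≤ C * ‖f‖ₑ := by simpa using hF_norm
  have hFp : MemLp F p := ⟨hF.1.continuous.aestronglyMeasurable,
    hF_le.trans_lt (ENNReal.mul_lt_top ENNReal.coe_lt_top enorm_lt_top)⟩
  have hFp_norm : ‖hFp.toLp F‖ ≤ C * ‖f‖ := by
    rw [Lp.norm_toLp]
    refine ENNReal.toReal_le_of_le_ofReal (by positivity) ?_
    rwa [ENNReal.ofReal_mul (by positivity), ofReal_norm, ENNReal.ofReal_coe_nnreal]
  set k : ℂ := -(2 * Real.pi) ^ 2 * (l ^ 2 : ℝ) with hk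
  have hk_norm : l ^ 2 ≤ ‖k‖ := by
    have hpi : 1 ≤ (2 * Real.pi) ^ 2 := by nlinarith [Real.pi_gt_three]
    simpa [hk, abs_of_pos Real.pi_pos] using le_mul_of_one_le_left (sq_nonneg l) hpi
  have hk_ne : k ≠ 0 := norm_pos_iff.1 ((pow_pos hl 2).trans_le hk_norm)
  have hlap : Δ (Lp.toTemperedDistribution (hFp.toLp F)) = k • Lp.toTemperedDistribution f := by
    rw [toTemperedDistribution_toLp hF, ← hfF]
    exact hf.laplacian_fourierMultiplierCLM (hasTemperateGrowth_comp_inv_smul M l) fun ξ hξ =>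
      comp_inv_smul_mul_norm_sq_eq hM hl hξ.1 hξ.2
  refine ⟨k⁻¹ • hFp.toLp F, ?_, ?_⟩
  · have hsmul : Lp.toTemperedDistribution (k⁻¹ • hFp.toLp F) =
        k⁻¹ • Lp.toTemperedDistribution (hFp.toLp F) :=
      map_smul (Lp.toTemperedDistributionCLM ℂ volume p) _ _
    rw [hsmul, ← TemperedDistribution.laplacianCLM_apply, map_smul,
      TemperedDistribution.laplacianCLM_apply, hlap, inv_smul_smul₀ hk_ne]
  · rw [norm_smul, norm_inv]
    calc ‖k‖⁻¹ * ‖hFp.toLp F‖ ≤ (l ^ 2)⁻¹ * (C * ‖f‖) := by gcongr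
      _ = C * (l ^ 2)⁻¹ * ‖f‖ := by ring

variable (p) in
theorem exists_seminorm_apply_le_of_hasSpectrumIn_annulus {a : ℝ} (ha : 0 < a) (b : ℝ) :
    ∃ q : Seminorm ℂ 𝓢(E, ℂ), Continuous q ∧ ∀ l : ℝ, 0 < l →
      ∀ f : Lp ℂ p (volume : Measure E),
        HasSpectrumIn {ξ | a * l ≤ ‖ξ‖ ∧ ‖ξ‖ ≤ b * l} (Lp.toTemperedDistribution f) →
        ∀ g, ‖Lp.toTemperedDistribution f g‖ ≤ (l ^ 2)⁻¹ * ‖f‖ * q g := by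
  obtain ⟨C, hC⟩ := exists_laplacian_eq_of_hasSpectrumIn_annulus (E := E) p ha b
  obtain ⟨q, hq, hq_le⟩ := exists_seminorm_toTemperedDistribution_apply_le (E := E) p
  let L := LineDeriv.laplacianCLM ℂ E 𝓢(E, ℂ)
  refine ⟨C • q.comp L.toLinearMap, (continuous_const.mul (hq.comp L.continuous)),
    fun l hl f hf g => ?_⟩
  obtain ⟨h, hfh, hh⟩ := hC l hl f hf
  calc ‖Lp.toTemperedDistribution f g‖ = ‖Lp.toTemperedDistribution h (L g)‖ := by
        rw [hfh, TemperedDistribution.laplacian_apply_apply, SchwartzMap.laplacianCLM_eq]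
    _ ≤ C * (l ^ 2)⁻¹ * ‖f‖ * q (L g) := (hq_le _ _).trans (by gcongr)
    _ = (l ^ 2)⁻¹ * ‖f‖ * (C * q (L g)) := by ring

end Bernstein

section DistLpNorm

variable {p : ℝ≥0∞} [Fact (1 ≤ p)] {u : 𝓢'(ℝ, ℂ)}

theorem distLpNorm_toTemperedDistribution (f : Lp ℂ p (volume : Measure ℝ)) :
    distLpNorm p (Lp.toTemperedDistribution f) = ‖f‖ₑ := by
  refine le_antisymm (iInf₂_le_of_le f rfl le_rfl) (le_iInf₂ fun g hg => ?_)
  rw [toTemperedDistribution_injective hg]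

theorem exists_toTemperedDistribution_eq (hu : distLpNorm p u ≠ ⊤) :
    ∃ f : Lp ℂ p (volume : Measure ℝ), Lp.toTemperedDistribution f = u := by
  by_contra! h
  exact hu (by simp [distLpNorm, h])

theorem distLpNorm_zero : distLpNorm p 0 = 0 := by
  have h : (0 : 𝓢'(ℝ, ℂ)) =
      Lp.toTemperedDistribution (0 : Lp ℂ p (volume : Measure ℝ)) :=
    (map_zero (Lp.toTemperedDistributionCLM ℂ volume p)).symm
  rw [h, distLpNorm_toTemperedDistribution, enorm_zero]

theorem distLpNorm_toTemperedDistribution_volume_le {F : ℝ → ℂ} (hF : F.HasTemperateGrowth) :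
    distLpNorm p (hF.toTemperedDistribution volume) ≤ eLpNorm F p := by
  rcases eq_top_or_lt_top (eLpNorm F p) with h | h
  · exact h ▸ le_top
  · have hp : MemLp F p := ⟨hF.1.continuous.aestronglyMeasurable, h⟩
    rw [← toTemperedDistribution_toLp hF hp, distLpNorm_toTemperedDistribution, Lp.enorm_toLp]

theorem distLpNorm_le_tsum {ι : Type*} {T : ι → 𝓢'(ℝ, ℂ)} {t : 𝓢'(ℝ, ℂ)} (h : HasSum T t) :
    distLpNorm p t ≤ ∑' i, distLpNorm p (T i) := by
  by_cases htop : ∑' i, distLpNorm p (T i) = ⊤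
  · simp [htop]
  choose f hf using fun i => exists_toTemperedDistribution_eq (ENNReal.ne_top_of_tsum_ne_top htop i)
  have hn : ∀ i, distLpNorm p (T i) = ‖f i‖ₑ := fun i => by
    rw [← hf, distLpNorm_toTemperedDistribution]
  simp_rw [hn] at htop ⊢
  have hs : Summable fun i => ‖f i‖ := by simpa using ENNReal.summable_toReal htop
  have hsum : HasSum T (Lp.toTemperedDistribution (∑' i, f i)) := by
    simpa [hf] using hs.of_norm.hasSum.mapL (Lp.toTemperedDistributionCLM ℂ volume p)
  rw [h.unique hsum, distLpNorm_toTemperedDistribution]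
  exact enorm_tsum_le_tsum_enorm

theorem exists_hasTemperateGrowth_of_hasSpectrumIn {R : ℝ} (hu : distLpNorm p u ≠ ⊤)
    (hR : HasSpectrumIn (Metric.closedBall 0 R) u) :
    ∃ (F : ℝ → ℂ) (hF : F.HasTemperateGrowth), u = hF.toTemperedDistribution volume ∧
      eLpNorm F p = distLpNorm p u := by
  obtain ⟨f, rfl⟩ := exists_toTemperedDistribution_eq hu
  obtain ⟨C, hC⟩ := exists_bernstein_of_hasSpectrumIn (E := ℝ) R p p le_rfl
  obtain ⟨F, hF, hfF, hF_norm⟩ := hC 1 one_pos f (by rwa [mul_one])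
  have hFp : MemLp F p := ⟨hF.1.continuous.aestronglyMeasurable, hF_norm.trans_lt (by
    simpa using ENNReal.mul_lt_top ENNReal.coe_lt_top enorm_lt_top)⟩
  refine ⟨F, hF, hfF, ?_⟩
  rw [hfF, ← toTemperedDistribution_toLp hF hFp, distLpNorm_toTemperedDistribution, Lp.enorm_toLp]

theorem exists_distLpNorm_le_of_hasSpectrumIn (R : ℝ) (a b : ℝ≥0∞) [Fact (1 ≤ a)] [Fact (1 ≤ b)]
    (hab : a ≤ b) : ∃ C : ℝ≥0, ∀ l : ℝ, 0 < l → ∀ u : 𝓢'(ℝ, ℂ),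
      HasSpectrumIn (Metric.closedBall 0 (R * l)) u →
      distLpNorm b u ≤ C * ENNReal.ofReal l ^ (a⁻¹.toReal - b⁻¹.toReal) * distLpNorm a u := by
  obtain ⟨C, hC⟩ := exists_bernstein_of_hasSpectrumIn (E := ℝ) R a b hab
  refine ⟨C + 1, fun l hl u hu => ?_⟩
  by_cases htop : distLpNorm a u = ⊤
  · have hl' : ENNReal.ofReal l ^ (a⁻¹.toReal - b⁻¹.toReal) ≠ 0 := by
      simp [ENNReal.rpow_eq_zero_iff, hl]
    rw [htop, ENNReal.mul_top (mul_ne_zero (by simp) hl')]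
    exact le_top
  obtain ⟨f, rfl⟩ := exists_toTemperedDistribution_eq htop
  obtain ⟨F, hF, hfF, hF_norm⟩ := hC l hl f hu
  rw [distLpNorm_toTemperedDistribution f, hfF]
  refine (distLpNorm_toTemperedDistribution_volume_le hF).trans (hF_norm.trans ?_)
  rw [Module.finrank_self, Nat.cast_one, one_mul]
  gcongr
  exact le_self_add

theorem exists_seminorm_apply_le_distLpNorm (p : ℝ≥0∞) [Fact (1 ≤ p)] :
    ∃ q : Seminorm ℂ 𝓢(ℝ, ℂ), Continuous q ∧ ∀ u : 𝓢'(ℝ, ℂ), distLpNorm p u ≠ ⊤ →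
      ∀ g, ‖u g‖ ≤ (distLpNorm p u).toReal * q g := by
  obtain ⟨q, hq, hq_le⟩ := exists_seminorm_toTemperedDistribution_apply_le (E := ℝ) p
  refine ⟨q, hq, fun u hu g => ?_⟩
  obtain ⟨f, rfl⟩ := exists_toTemperedDistribution_eq hu
  simpa [distLpNorm_toTemperedDistribution] using hq_le f g

theorem exists_seminorm_apply_le_distLpNorm_of_annulus (p : ℝ≥0∞) [Fact (1 ≤ p)] {a : ℝ}
    (ha : 0 < a) (b : ℝ) : ∃ q : Seminorm ℂ 𝓢(ℝ, ℂ), Continuous q ∧ ∀ l : ℝ, 0 < l →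
      ∀ u : 𝓢'(ℝ, ℂ), distLpNorm p u ≠ ⊤ → HasSpectrumIn {ξ | a * l ≤ ‖ξ‖ ∧ ‖ξ‖ ≤ b * l} u →
      ∀ g, ‖u g‖ ≤ (l ^ 2)⁻¹ * (distLpNorm p u).toReal * q g := by
  obtain ⟨q, hq, hq_le⟩ := exists_seminorm_apply_le_of_hasSpectrumIn_annulus (E := ℝ) p ha b
  refine ⟨q, hq, fun l hl u hu hs g => ?_⟩
  obtain ⟨f, rfl⟩ := exists_toTemperedDistribution_eq hu
  simpa [distLpNorm_toTemperedDistribution] using hq_le l hl f hs g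

end DistLpNorm

section Blocks

variable {χ φ : ℝ → ℝ}

/-- The frequencies of the `j`-th dyadic block: a set that contains the support of
`dyadicSymbol χ φ j` for every Littlewood-Paley pair `(χ, φ)`. -/
def dyadicRing (j : ℤ) : Set ℝ :=
  {ξ | -1 ≤ j ∧ |ξ| ≤ 8 / 3 * (2 : ℝ) ^ j ∧ (0 ≤ j → 3 / 4 * (2 : ℝ) ^ j ≤ |ξ|)}

theorem dyadicRing_subset_closedBall (j : ℤ) :
    dyadicRing j ⊆ Metric.closedBall 0 (8 / 3 * (2 : ℝ) ^ j) :=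
  fun _ hξ => mem_closedBall_zero_iff.2 hξ.2.1

open scoped Pointwise in
theorem dyadicRing_add_dyadicRing_subset_closedBall (i j : ℤ) :
    dyadicRing i + dyadicRing j ⊆ Metric.closedBall 0 (16 / 3 * (2 : ℝ) ^ max i j) := by
  rintro _ ⟨ξ, hξ, η, hη, rfl⟩
  have hi : (2 : ℝ) ^ i ≤ 2 ^ max i j := zpow_le_zpow_right₀ one_le_two (le_max_left i j)
  have hj : (2 : ℝ) ^ j ≤ 2 ^ max i j := zpow_le_zpow_right₀ one_le_two (le_max_right i j)
  rw [mem_closedBall_zero_iff, Real.norm_eq_abs]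
  linarith [abs_add_le ξ η, hξ.2.1, hη.2.1]

open scoped Pointwise in
theorem dyadicRing_add_dyadicRing_subset_annulus {i j : ℤ} (hij : 2 < |i - j|) :
    dyadicRing i + dyadicRing j ⊆
      {ξ | 5 / 12 * (2 : ℝ) ^ max i j ≤ ‖ξ‖ ∧ ‖ξ‖ ≤ 16 / 3 * (2 : ℝ) ^ max i j} := by
  wlog h : j ≤ i generalizing i j
  · rw [add_comm, max_comm]
    exact this (by rwa [abs_sub_comm]) (le_of_not_ge h)
  intro ζ hζ
  refine ⟨?_, mem_closedBall_zero_iff.1 (dyadicRing_add_dyadicRing_subset_closedBall i j hζ)⟩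
  obtain ⟨ξ, hξ, η, hη, rfl⟩ := hζ
  have hji : j ≤ i - 3 := by
    rw [abs_of_nonneg (by omega)] at hij
    omega
  have hξ_low := hξ.2.2 (by have := hη.1; omega)
  have hpow : (2 : ℝ) ^ j ≤ 2 ^ i / 8 := by
    have := zpow_le_zpow_right₀ (one_le_two (α := ℝ)) hji
    rwa [zpow_sub₀ two_ne_zero, show (2 : ℝ) ^ (3 : ℤ) = 8 by norm_num] at this
  have htri : |ξ| - |η| ≤ |ξ + η| := by simpa using abs_sub_abs_le_abs_sub ξ (-η)
  rw [max_eq_left h, Real.norm_eq_abs]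
  linarith [hη.2.1]

namespace IsLittlewoodPaleyPair

theorem high_bounds (h : IsLittlewoodPaleyPair χ φ) {ξ : ℝ} (hξ : φ ξ ≠ 0) :
    3 / 4 ≤ |ξ| ∧ |ξ| ≤ 8 / 3 :=
  h.tsupport_high (subset_tsupport φ hξ)

theorem low_bound (h : IsLittlewoodPaleyPair χ φ) {ξ : ℝ} (hξ : χ ξ ≠ 0) : |ξ| ≤ 4 / 3 :=
  h.tsupport_low (subset_tsupport χ hξ)

theorem dyadicSymbol_eq_zero (h : IsLittlewoodPaleyPair χ φ) {j : ℤ} {ξ : ℝ}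
    (hξ : ξ ∉ dyadicRing j) : dyadicSymbol χ φ j ξ = 0 := by
  contrapose! hξ
  unfold dyadicSymbol at hξ
  split_ifs at hξ with hj hj'
  · exact absurd rfl hξ
  · subst hj'
    have hξ' : |ξ| ≤ 4 / 3 := h.low_bound (by simpa using hξ)
    exact ⟨le_rfl, hξ'.trans (by norm_num), by norm_num⟩
  · have hξ' := h.high_bounds (by simpa using hξ)
    have hpos : (0 : ℝ) < 2 ^ j := by positivity
    rw [abs_mul, abs_of_pos (inv_pos.2 hpos), ← div_eq_inv_mul, le_div_iff₀ hpos,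
      div_le_iff₀ hpos] at hξ'
    exact ⟨by omega, hξ'.2, fun _ => hξ'.1⟩

theorem exists_finite_dyadicSymbol_eq (h : IsLittlewoodPaleyPair χ φ) :
    ∃ S : Set 𝓢(ℝ, ℂ), S.Finite ∧
      ∀ j, ∃ M ∈ S, dyadicSymbol χ φ j = fun ξ => M (((2 : ℝ) ^ j)⁻¹ • ξ) := by
  have hlow : HasCompactSupport fun ξ => χ (2⁻¹ * ξ) := by
    refine .intro (isCompact_closedBall 0 (8 / 3)) fun ξ hξ => ?_
    contrapose! hξ
    have := h.low_bound hξ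
    rw [abs_mul, abs_of_pos (by norm_num)] at this
    simpa using (by linarith : |ξ| ≤ 8 / 3)
  have hhigh : HasCompactSupport φ := .intro (isCompact_closedBall 0 (8 / 3)) fun ξ hξ => by
    contrapose! hξ
    simpa using (h.high_bounds hξ).2
  obtain ⟨M, hM⟩ := exists_schwartzMap_eq_ofReal (h.contDiff_low.comp (by fun_prop)) hlow
  obtain ⟨N, hN⟩ := exists_schwartzMap_eq_ofReal h.contDiff_high hhigh
  refine ⟨{0, M, N}, by simp, fun j => ?_⟩
  rcases lt_trichotomy j (-1) with hj | rfl | hj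
  · exact ⟨0, by simp, by ext ξ; simp [dyadicSymbol, show j ≤ -2 by omega]⟩
  · exact ⟨M, by simp, by ext ξ; simp [dyadicSymbol, hM]⟩
  · refine ⟨N, by simp, ?_⟩
    ext ξ
    rw [hN, dyadicSymbol, if_neg (by omega), if_neg (by omega), zpow_neg, smul_eq_mul]

theorem hasTemperateGrowth_dyadicSymbol (h : IsLittlewoodPaleyPair χ φ) (j : ℤ) :
    (dyadicSymbol χ φ j).HasTemperateGrowth := by
  obtain ⟨S, -, hS⟩ := h.exists_finite_dyadicSymbol_eq
  obtain ⟨M, -, hM⟩ := hS j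
  exact hM ▸ hasTemperateGrowth_comp_inv_smul M _

theorem hasSpectrumIn_dyadicBlock (h : IsLittlewoodPaleyPair χ φ) (j : ℤ) (u : 𝓢'(ℝ, ℂ)) :
    HasSpectrumIn (dyadicRing j) (dyadicBlock χ φ j u) :=
  hasSpectrumIn_fourierMultiplierCLM (h.hasTemperateGrowth_dyadicSymbol j)
    (fun _ => h.dyadicSymbol_eq_zero) u

theorem dyadicBlock_eq_zero (h : IsLittlewoodPaleyPair χ φ) {j : ℤ} {s : Set ℝ} {u : 𝓢'(ℝ, ℂ)}
    (hu : HasSpectrumIn s u) (hs : Disjoint s (dyadicRing j)) : dyadicBlock χ φ j u = 0 :=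
  (hu.fourierMultiplierCLM_eq_smul (h.hasTemperateGrowth_dyadicSymbol j) fun _ hξ =>
    h.dyadicSymbol_eq_zero (hs.notMem_of_mem_left hξ)).trans (zero_smul ℂ u)

theorem exists_distLpNorm_dyadicBlock_le (h : IsLittlewoodPaleyPair χ φ) (p : ℝ≥0∞)
    [Fact (1 ≤ p)] : ∃ C : ℝ≥0, ∀ j u,
      distLpNorm p (dyadicBlock χ φ j u) ≤ C * distLpNorm p u := by
  obtain ⟨S, hS_fin, hS⟩ := h.exists_finite_dyadicSymbol_eq
  choose C hC using fun M : 𝓢(ℝ, ℂ) => exists_bernstein M p p le_rfl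
  refine ⟨hS_fin.toFinset.sup C + 1, fun j u => ?_⟩
  by_cases htop : distLpNorm p u = ⊤
  · rw [htop, ENNReal.mul_top (by simp)]
    exact le_top
  obtain ⟨f, rfl⟩ := exists_toTemperedDistribution_eq htop
  obtain ⟨M, hMS, hM⟩ := hS j
  obtain ⟨F, hF, hfF, hF_norm⟩ := hC M (2 ^ j) (by positivity) f
  rw [dyadicBlock, hM, hfF, distLpNorm_toTemperedDistribution]
  refine (distLpNorm_toTemperedDistribution_volume_le hF).trans (hF_norm.trans ?_)
  rw [sub_self, mul_zero, ENNReal.rpow_zero, mul_one]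
  gcongr
  exact (Finset.le_sup (hS_fin.mem_toFinset.2 hMS)).trans le_self_add

end IsLittlewoodPaleyPair

end Blocks

section Sequences

section Count

variable {ι : Type*} [MeasurableSpace ι] [DiscreteMeasurableSpace ι]

theorem eLpNorm_count_le_of_exponent_ge (a : ι → ℝ≥0∞) {r r' : ℝ≥0∞} (hr : r ≠ 0) (h : r ≤ r') :
    eLpNorm a r' Measure.count ≤ eLpNorm a r Measure.count := by
  have hsup (i : ι) : a i ≤ eLpNorm a r Measure.count := by
    simpa using enorm_le_eLpNorm_count a i hr
  rcases eq_or_ne r' ⊤ with rfl | hr'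
  · exact essSup_le_of_ae_le _ (.of_forall hsup)
  have hr0 : r' ≠ 0 := (hr.bot_lt.trans_le h).ne'
  have hr_top : r ≠ ⊤ := ne_top_of_le_ne_top hr' h
  have hrr : 0 ≤ r'.toReal - r.toReal := sub_nonneg.2 (ENNReal.toReal_mono hr' h)
  have hpos : 0 < r.toReal := ENNReal.toReal_pos hr hr_top
  have hnorm {t : ℝ≥0∞} (ht : t ≠ 0) (ht' : t ≠ ⊤) :
      eLpNorm a t Measure.count ^ t.toReal = ∑' i, a i ^ t.toReal := by
    rw [eLpNorm_eq_lintegral_rpow_enorm_toReal ht ht', one_div,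
      ENNReal.rpow_inv_rpow (ENNReal.toReal_pos ht ht').ne', lintegral_count]
    simp only [enorm_eq_self]
  rw [← ENNReal.rpow_le_rpow_iff (ENNReal.toReal_pos hr0 hr'), hnorm hr0 hr']
  calc ∑' i, a i ^ r'.toReal
      ≤ ∑' i, eLpNorm a r Measure.count ^ (r'.toReal - r.toReal) * a i ^ r.toReal :=
        ENNReal.tsum_le_tsum fun i => by
          nth_rw 1 [← sub_add_cancel r'.toReal r.toReal,
            ENNReal.rpow_add_of_nonneg _ _ hrr hpos.le]
          gcongr
          exact hsup i
    _ = eLpNorm a r Measure.count ^ r'.toReal := by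
        rw [ENNReal.tsum_mul_left, ← hnorm hr hr_top, ← ENNReal.rpow_add_of_nonneg _ _ hrr hpos.le,
          sub_add_cancel]

theorem eLpNorm_count_one (a : ι → ℝ≥0∞) : eLpNorm a 1 Measure.count = ∑' i, a i := by
  simp [eLpNorm_one_eq_lintegral_enorm, lintegral_count]

theorem eLpNorm_count_two (a : ι → ℝ≥0∞) :
    eLpNorm a 2 Measure.count = (∑' i, a i ^ (2 : ℝ)) ^ (1 / 2 : ℝ) := by
  simp [eLpNorm_eq_lintegral_rpow_enorm_toReal, lintegral_count]

theorem eLpNorm_count_two_comp_equiv (a : ι → ℝ≥0∞) (e : ι ≃ ι) :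
    eLpNorm (fun i => a (e i)) 2 Measure.count = eLpNorm a 2 Measure.count := by
  rw [eLpNorm_count_two, eLpNorm_count_two, ← e.tsum_eq fun i => a i ^ (2 : ℝ)]

theorem tsum_mul_le_eLpNorm_count_two (a b : ι → ℝ≥0∞) :
    ∑' i, a i * b i ≤ eLpNorm a 2 Measure.count * eLpNorm b 2 Measure.count := by
  have hHolder := ENNReal.lintegral_mul_le_Lp_mul_Lq (Measure.count : Measure ι)
    Real.HolderConjugate.two_two (f := a) (g := b) Measurable.of_discrete.aemeasurable
    Measurable.of_discrete.aemeasurable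
  simpa only [lintegral_count, Pi.mul_apply, ← eLpNorm_count_two] using hHolder

end Count

theorem ofReal_two_zpow (j : ℤ) : ENNReal.ofReal ((2 : ℝ) ^ j) = (2 : ℝ≥0∞) ^ (j : ℝ) := by
  rw [← Real.rpow_intCast, ← ENNReal.ofReal_rpow_of_pos two_pos, ENNReal.ofReal_ofNat]

theorem two_rpow_add (x y : ℝ) : (2 : ℝ≥0∞) ^ (x + y) = 2 ^ x * 2 ^ y :=
  ENNReal.rpow_add _ _ two_ne_zero ENNReal.ofNat_ne_top

theorem two_rpow_le_two_rpow {x y : ℝ} (h : x ≤ y) : (2 : ℝ≥0∞) ^ x ≤ 2 ^ y :=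
  ENNReal.rpow_le_rpow_of_exponent_le one_le_two h

theorem two_rpow_ne_top (x : ℝ) : (2 : ℝ≥0∞) ^ x ≠ ⊤ :=
  ENNReal.rpow_ne_top_of_ne_zero two_ne_zero ENNReal.ofNat_ne_top

theorem tsum_two_rpow_neg_mul_ne_top {ε : ℝ} (hε : 0 < ε) :
    ∑' j : ℤ, (if -1 ≤ j then (2 : ℝ≥0∞) ^ (-(j * ε)) else 0) ≠ ⊤ := by
  have hinj : Function.Injective fun n : ℕ => (n : ℤ) - 1 := fun a b hab => by simpa using hab
  rw [← hinj.tsum_eq]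
  swap
  · intro j hj
    have : -1 ≤ j := by
      by_contra h
      exact hj (if_neg h)
    exact ⟨(j + 1).toNat, by simp only; omega⟩
  have hterm (n : ℕ) : (if -1 ≤ (n : ℤ) - 1 then (2 : ℝ≥0∞) ^ (-(((n : ℤ) - 1 : ℤ) * ε)) else 0) =
      2 ^ ε * (2 ^ (-ε)) ^ n := by
    rw [if_pos (by omega), ← ENNReal.rpow_natCast, ← ENNReal.rpow_mul, ← two_rpow_add]
    congr 1
    push_cast
    ring
  simp_rw [hterm]
  rw [ENNReal.tsum_mul_left, ENNReal.tsum_geometric]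
  refine ENNReal.mul_ne_top (two_rpow_ne_top _) (ENNReal.inv_ne_top.2 (tsub_pos_of_lt ?_).ne')
  exact ENNReal.rpow_lt_one_of_one_lt_of_neg ENNReal.one_lt_two (neg_lt_zero.2 hε)

theorem exists_tsum_two_rpow_mul_le {ε : ℝ} (hε : 0 < ε) : ∃ C : ℝ≥0,
    ∀ (r : ℝ≥0∞) (a : ℤ → ℝ≥0∞), r ≠ 0 → (∀ j, j < -1 → a j = 0) →
      ∑' j : ℤ, 2 ^ (-(j * ε)) * a j ≤ C * eLpNorm a r Measure.count := by
  refine ⟨(∑' j : ℤ, (if -1 ≤ j then (2 : ℝ≥0∞) ^ (-(j * ε)) else 0)).toNNReal,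
    fun r a hr ha => ?_⟩
  rw [ENNReal.coe_toNNReal (tsum_two_rpow_neg_mul_ne_top hε), ← ENNReal.tsum_mul_right]
  refine ENNReal.tsum_le_tsum fun j => ?_
  split_ifs with hj
  · gcongr
    simpa using enorm_le_eLpNorm_count a j hr
  · simp [ha j (not_le.1 hj)]

theorem tsum_near_diagonal_le (a b : ℤ → ℝ≥0∞) :
    ∑' i, ∑' j, (if |i - j| ≤ 2 then a i * b j else 0) ≤
      5 * (eLpNorm a 2 Measure.count * eLpNorm b 2 Measure.count) := by
  have hband : ∀ i j, (if |i - j| ≤ 2 then a i * b j else 0) ≤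
      ∑ d ∈ Finset.Icc (-2 : ℤ) 2, if j = i + d then a i * b j else 0 := fun i j => by
    split_ifs with hij
    · have hmem : j - i ∈ Finset.Icc (-2 : ℤ) 2 := by
        rw [abs_le] at hij
        exact Finset.mem_Icc.2 ⟨by omega, by omega⟩
      refine le_trans ?_ (Finset.single_le_sum (fun _ _ => zero_le) hmem)
      rw [if_pos (by ring)]
    · exact zero_le
  calc _ ≤ ∑' i, ∑' j, ∑ d ∈ Finset.Icc (-2 : ℤ) 2, (if j = i + d then a i * b j else 0) :=
        ENNReal.tsum_le_tsum fun i => ENNReal.tsum_le_tsum (hband i)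
    _ = ∑ d ∈ Finset.Icc (-2 : ℤ) 2, ∑' i, a i * b (i + d) := by
        rw [← Summable.tsum_finsetSum fun _ _ => ENNReal.summable]
        refine tsum_congr fun i => ?_
        rw [Summable.tsum_finsetSum fun _ _ => ENNReal.summable]
        simp only [tsum_ite_eq]
    _ ≤ ∑ _d ∈ Finset.Icc (-2 : ℤ) 2, eLpNorm a 2 Measure.count * eLpNorm b 2 Measure.count := by
        refine Finset.sum_le_sum fun d _ => ?_
        rw [← eLpNorm_count_two_comp_equiv b (Equiv.addRight d)]
        exact tsum_mul_le_eLpNorm_count_two a fun i => b (i + d)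
    _ = _ := by simp

/-- A weight on pairs of frequencies `2 ^ i` and `2 ^ j`: no gain for comparable frequencies, a
gain of `ε` powers of the larger one otherwise. -/
noncomputable def pairWeight (ε : ℝ) (i j : ℤ) : ℝ≥0∞ :=
  if |i - j| ≤ 2 then 1 else 2 ^ (-(((max i j : ℤ) : ℝ) * ε))

theorem exists_tsum_pairWeight_mul_le {ε : ℝ} (hε : 0 < ε) : ∃ C : ℝ≥0,
    ∀ a b : ℤ → ℝ≥0∞, (∀ i, i < -1 → a i = 0) → (∀ j, j < -1 → b j = 0) →
      ∑' x : ℤ × ℤ, pairWeight ε x.1 x.2 * (a x.1 * b x.2) ≤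
        C * (eLpNorm a 2 Measure.count * eLpNorm b 2 Measure.count) := by
  obtain ⟨C, hC⟩ := exists_tsum_two_rpow_mul_le (half_pos hε)
  refine ⟨5 + C * C, fun a b ha hb => ?_⟩
  have hweight (i j : ℤ) : pairWeight ε i j * (a i * b j) ≤
      (if |i - j| ≤ 2 then a i * b j else 0) +
        2 ^ (-(i * (ε / 2))) * a i * (2 ^ (-(j * (ε / 2))) * b j) := by
    unfold pairWeight
    split_ifs
    · rw [one_mul]
      exact le_self_add
    · have hmax : ((i : ℝ) + j) / 2 ≤ (max i j : ℤ) := by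
        rw [Int.cast_max]
        linarith [le_max_left (i : ℝ) j, le_max_right (i : ℝ) j]
      rw [zero_add, mul_mul_mul_comm, ← two_rpow_add]
      refine mul_le_mul_left (two_rpow_le_two_rpow ?_) _
      nlinarith
  calc ∑' x : ℤ × ℤ, pairWeight ε x.1 x.2 * (a x.1 * b x.2)
      = ∑' i, ∑' j, pairWeight ε i j * (a i * b j) :=
        ENNReal.tsum_prod (f := fun i j => pairWeight ε i j * (a i * b j))
    _ ≤ ∑' i, ∑' j, ((if |i - j| ≤ 2 then a i * b j else 0) +
          2 ^ (-(i * (ε / 2))) * a i * (2 ^ (-(j * (ε / 2))) * b j)) :=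
        ENNReal.tsum_le_tsum fun i => ENNReal.tsum_le_tsum (hweight i)
    _ = ∑' i, ∑' j, (if |i - j| ≤ 2 then a i * b j else 0) +
          (∑' i : ℤ, 2 ^ (-(i * (ε / 2))) * a i) * ∑' j : ℤ, 2 ^ (-(j * (ε / 2))) * b j := by
        simp_rw [ENNReal.tsum_add, ENNReal.tsum_mul_left, ENNReal.tsum_mul_right]
    _ ≤ 5 * (eLpNorm a 2 Measure.count * eLpNorm b 2 Measure.count) +
          (C * eLpNorm a 2 Measure.count) * (C * eLpNorm b 2 Measure.count) := by
        gcongr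
        · exact tsum_near_diagonal_le a b
        · exact hC 2 a two_ne_zero ha
        · exact hC 2 b two_ne_zero hb
    _ = _ := by
        push_cast
        ring

end Sequences

section Besov

variable {χ φ : ℝ → ℝ} {p q r r' : ℝ≥0∞} [Fact (1 ≤ p)] [Fact (1 ≤ q)] {σ τ : ℝ}

theorem dyadicBlock_of_lt {j : ℤ} (hj : j < -1) (u : 𝓢'(ℝ, ℂ)) : dyadicBlock χ φ j u = 0 := by
  have hsymbol : dyadicSymbol χ φ j = fun _ => 0 := by
    ext ξ
    rw [dyadicSymbol, if_pos (by omega)]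
  rw [dyadicBlock, hsymbol, TemperedDistribution.fourierMultiplierCLM_const, zero_smul,
    zero_apply]

theorem distLpNorm_dyadicBlock_of_lt {j : ℤ} (hj : j < -1) (u : 𝓢'(ℝ, ℂ)) :
    distLpNorm p (dyadicBlock χ φ j u) = 0 := by
  rw [dyadicBlock_of_lt hj, distLpNorm_zero]

theorem distLpNorm_dyadicBlock_ne_top (hr : r ≠ 0) {u : 𝓢'(ℝ, ℂ)} (hu : MemBesov χ φ σ p r u)
    (j : ℤ) : distLpNorm p (dyadicBlock χ φ j u) ≠ ⊤ := by
  have hle : (2 : ℝ≥0∞) ^ (j * σ) * distLpNorm p (dyadicBlock χ φ j u) ≤ besovNorm χ φ σ p r u := by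
    simpa [besovNorm] using enorm_le_eLpNorm_count
      (fun j : ℤ => (2 : ℝ≥0∞) ^ ((j : ℝ) * σ) * distLpNorm p (dyadicBlock χ φ j u)) j hr
  intro htop
  rw [htop, ENNReal.mul_top (by simp)] at hle
  exact (hle.trans_lt hu).ne rfl

theorem besovNorm_le_of_exponent_ge (hr : r ≠ 0) (h : r ≤ r') (u : 𝓢'(ℝ, ℂ)) :
    besovNorm χ φ σ p r' u ≤ besovNorm χ φ σ p r u :=
  eLpNorm_count_le_of_exponent_ge _ hr h

theorem besovNorm_le_of_le (h : τ ≤ σ) (u : 𝓢'(ℝ, ℂ)) :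
    besovNorm χ φ τ p r u ≤ ((2 : ℝ≥0) ^ (σ - τ) : ℝ≥0) * besovNorm χ φ σ p r u := by
  refine (eLpNorm_le_nnreal_smul_eLpNorm_of_ae_le_mul' (.of_forall fun j => ?_) r).trans_eq
    (ENNReal.smul_def _ _)
  simp only [enorm_eq_self]
  by_cases hj : j < -1
  · simp [distLpNorm_dyadicBlock_of_lt hj]
  have hj' : (-1 : ℝ) ≤ j := by exact_mod_cast not_lt.1 hj
  rw [ENNReal.coe_rpow_of_ne_zero two_ne_zero, ENNReal.coe_ofNat, ← mul_assoc, ← two_rpow_add]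
  gcongr
  · exact one_le_two
  · nlinarith

theorem exists_besovNorm_one_le (p : ℝ≥0∞) [Fact (1 ≤ p)] (h : τ < σ) : ∃ C : ℝ≥0, ∀ r u, r ≠ 0 →
    besovNorm χ φ τ p 1 u ≤ C * besovNorm χ φ σ p r u := by
  obtain ⟨C, hC⟩ := exists_tsum_two_rpow_mul_le (sub_pos.2 h)
  refine ⟨C, fun r u hr => ?_⟩
  refine le_of_eq_of_le ?_ (hC r (fun j => 2 ^ (j * σ) * distLpNorm p (dyadicBlock χ φ j u)) hr
    fun j hj => by rw [distLpNorm_dyadicBlock_of_lt hj, mul_zero])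
  rw [besovNorm, eLpNorm_count_one]
  refine tsum_congr fun j => ?_
  rw [← mul_assoc, ← two_rpow_add]
  congr 2
  ring

namespace IsLittlewoodPaleyPair

theorem exists_besovNorm_sobolev_le (h : IsLittlewoodPaleyPair χ φ) (hpq : p ≤ q) (σ : ℝ) :
    ∃ C : ℝ≥0, ∀ r u, besovNorm χ φ (σ - (p⁻¹.toReal - q⁻¹.toReal)) q r u ≤
      C * besovNorm χ φ σ p r u := by
  obtain ⟨C, hC⟩ := exists_distLpNorm_le_of_hasSpectrumIn (8 / 3) p q hpq
  refine ⟨C, fun r u => ?_⟩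
  refine (eLpNorm_le_nnreal_smul_eLpNorm_of_ae_le_mul' (.of_forall fun j => ?_) r).trans_eq
    (ENNReal.smul_def _ _)
  simp only [enorm_eq_self]
  have hj := hC (2 ^ j) (by positivity) (dyadicBlock χ φ j u)
    ((h.hasSpectrumIn_dyadicBlock j u).mono (dyadicRing_subset_closedBall j))
  rw [ofReal_two_zpow, ← ENNReal.rpow_mul] at hj
  calc _ ≤ (2 : ℝ≥0∞) ^ (j * (σ - (p⁻¹.toReal - q⁻¹.toReal))) *
        (C * 2 ^ (j * (p⁻¹.toReal - q⁻¹.toReal)) * distLpNorm p (dyadicBlock χ φ j u)) := by gcongr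
    _ = C * (2 ^ (j * (σ - (p⁻¹.toReal - q⁻¹.toReal)) + j * (p⁻¹.toReal - q⁻¹.toReal)) *
        distLpNorm p (dyadicBlock χ φ j u)) := by
        rw [two_rpow_add]
        ring
    _ = _ := by rw [← mul_add, sub_add_cancel]

theorem exists_besovNorm_le (h : IsLittlewoodPaleyPair χ φ) (hpq : p ≤ q) (hr : r ≠ 0)
    (hr' : 1 ≤ r') (hτ : τ < σ - (p⁻¹.toReal - q⁻¹.toReal) ∨
      (τ = σ - (p⁻¹.toReal - q⁻¹.toReal) ∧ r ≤ r')) :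
    ∃ C : ℝ≥0, ∀ u, besovNorm χ φ τ q r' u ≤ C * besovNorm χ φ σ p r u := by
  obtain ⟨C, hC⟩ := h.exists_besovNorm_sobolev_le hpq σ
  rcases hτ with hlt | ⟨rfl, hrr'⟩
  · obtain ⟨C', hC'⟩ := exists_besovNorm_one_le (χ := χ) (φ := φ) q hlt
    refine ⟨C' * C, fun u => ?_⟩
    calc besovNorm χ φ τ q r' u ≤ besovNorm χ φ τ q 1 u :=
          besovNorm_le_of_exponent_ge one_ne_zero hr' u
      _ ≤ C' * besovNorm χ φ (σ - (p⁻¹.toReal - q⁻¹.toReal)) q r u := hC' r u hr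
      _ ≤ C' * (C * besovNorm χ φ σ p r u) := by
          gcongr
          exact hC r u
      _ = _ := by rw [ENNReal.coe_mul, mul_assoc]
  · exact ⟨C, fun u => (besovNorm_le_of_exponent_ge hr hrr' u).trans (hC r u)⟩

end IsLittlewoodPaleyPair

end Besov

section Product

open scoped Pointwise

variable {χ φ : ℝ → ℝ} {m : ℝ≥0∞} [Fact (1 ≤ m)]

theorem exists_isSmoothProduct {q q' : ℝ≥0∞} [Fact (1 ≤ q)] [Fact (1 ≤ q')]
    [ENNReal.HolderTriple q q' m] {S T : 𝓢'(ℝ, ℂ)} {R : ℝ} {s t : Set ℝ} (hS : distLpNorm q S ≠ ⊤)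
    (hT : distLpNorm q' T ≠ ⊤) (hs : HasSpectrumIn s S) (hsR : s ⊆ Metric.closedBall 0 R)
    (ht : HasSpectrumIn t T) :
    ∃ P, IsSmoothProduct S T P ∧ distLpNorm m P ≤ distLpNorm q S * distLpNorm q' T ∧
      HasSpectrumIn (s + t) P := by
  obtain ⟨F, hF, rfl, hF_norm⟩ := exists_hasTemperateGrowth_of_hasSpectrumIn hS (hs.mono hsR)
  obtain ⟨g, rfl⟩ := exists_toTemperedDistribution_eq hT
  have hFq : MemLp F q := ⟨hF.1.continuous.aestronglyMeasurable, hF_norm ▸ hS.lt_top⟩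
  refine ⟨_, ⟨F, hF, rfl, rfl⟩, ?_, hs.smulLeftCLM hF ht⟩
  rw [← Lp.toTemperedDistribution_smul_eq (r := m) hF hFq g, distLpNorm_toTemperedDistribution,
    distLpNorm_toTemperedDistribution, ← hF_norm, ← Lp.enorm_toLp hFq]
  simp only [← ofReal_norm]
  rw [← ENNReal.ofReal_mul (norm_nonneg _)]
  exact ENNReal.ofReal_le_ofReal (Lp.norm_smul_le _ _)

theorem pairWeight_ne_zero (ε : ℝ) (i j : ℤ) : pairWeight ε i j ≠ 0 := by
  unfold pairWeight
  split_ifs <;> simp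

theorem exists_seminorm_apply_le_pairWeight (m : ℝ≥0∞) [Fact (1 ≤ m)] :
    ∃ q : Seminorm ℂ 𝓢(ℝ, ℂ), Continuous q ∧ ∀ (i j : ℤ) (u : 𝓢'(ℝ, ℂ)), distLpNorm m u ≠ ⊤ →
      HasSpectrumIn (dyadicRing i + dyadicRing j) u →
      ∀ g, ‖u g‖ ≤ (pairWeight 2 i j * distLpNorm m u).toReal * q g := by
  obtain ⟨q₁, hq₁, hq₁_le⟩ := exists_seminorm_apply_le_distLpNorm m
  obtain ⟨q₂, hq₂, hq₂_le⟩ :=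
    exists_seminorm_apply_le_distLpNorm_of_annulus m (show (0 : ℝ) < 5 / 12 by norm_num) (16 / 3)
  refine ⟨q₁ + q₂, hq₁.add hq₂, fun i j u hu hij g => ?_⟩
  rw [ENNReal.toReal_mul]
  by_cases hclose : |i - j| ≤ 2
  · rw [pairWeight, if_pos hclose, ENNReal.toReal_one, one_mul]
    refine (hq₁_le u hu g).trans (mul_le_mul_of_nonneg_left ?_ ENNReal.toReal_nonneg)
    exact le_add_of_nonneg_right (apply_nonneg q₂ g)
  · have hweight : (pairWeight 2 i j).toReal = (((2 : ℝ) ^ max i j) ^ 2)⁻¹ := by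
      rw [pairWeight, if_neg hclose, ← ENNReal.toReal_rpow, ENNReal.toReal_ofNat,
        Real.rpow_neg zero_le_two, ← zpow_natCast, ← zpow_mul, ← Real.rpow_intCast]
      push_cast
      rfl
    rw [hweight]
    refine (hq₂_le (2 ^ max i j) (by positivity) u hu
      (hij.mono (dyadicRing_add_dyadicRing_subset_annulus (not_le.1 hclose))) g).trans ?_
    gcongr
    exact le_add_of_nonneg_left (apply_nonneg q₁ g)

theorem exists_hasSum_of_tsum_pairWeight_ne_top {P : ℤ × ℤ → 𝓢'(ℝ, ℂ)}
    (hP : ∀ i j, HasSpectrumIn (dyadicRing i + dyadicRing j) (P (i, j)))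
    (hsum : ∑' x : ℤ × ℤ, pairWeight 2 x.1 x.2 * distLpNorm m (P x) ≠ ⊤) :
    ∃ w, HasSum P w := by
  obtain ⟨q, hq, hq_le⟩ := exists_seminorm_apply_le_pairWeight m
  refine exists_hasSum_of_norm_apply_le hq (ENNReal.summable_toReal hsum) fun x g => ?_
  refine hq_le x.1 x.2 (P x) (fun htop => ?_) (hP x.1 x.2) g
  refine ENNReal.ne_top_of_tsum_ne_top hsum x ?_
  rw [htop, ENNReal.mul_top (pairWeight_ne_zero _ _ _)]

/-- The `i`-th block of one distribution and the `j`-th block of another interact at frequency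
`2 ^ k`: outside this range of indices, the `k`-th block of their product vanishes. -/
def Interact (i j k : ℤ) : Prop :=
  -1 ≤ i ∧ -1 ≤ j ∧ -1 ≤ k ∧ k ≤ max i j + 2 ∧ (|i - j| ≤ 2 ∨ max i j ≤ k + 2)

theorem disjoint_dyadicRing_add_dyadicRing {i j k : ℤ}
    (h : ¬ Interact i j k) :
    Disjoint (dyadicRing i + dyadicRing j) (dyadicRing k) := by
  have hpow {a b : ℤ} (hab : a + 2 < b) : (2 : ℝ) ^ a * 8 ≤ 2 ^ b := by
    rw [show (8 : ℝ) = 2 ^ (3 : ℤ) by norm_num, ← zpow_add₀ two_ne_zero]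
    exact zpow_le_zpow_right₀ one_le_two (by omega)
  have hpos (a : ℤ) : (0 : ℝ) < 2 ^ a := by positivity
  refine Set.disjoint_left.2 fun ξ hξ hk => h ?_
  obtain ⟨hi, hj⟩ : -1 ≤ i ∧ -1 ≤ j := by
    obtain ⟨_, hi, _, hj, -⟩ := hξ
    exact ⟨hi.1, hj.1⟩
  refine ⟨hi, hj, hk.1, ?_, or_iff_not_imp_left.2 fun hfar => ?_⟩
  · by_contra! hlt
    have hξ_le := mem_closedBall_zero_iff.1 (dyadicRing_add_dyadicRing_subset_closedBall i j hξ)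
    rw [Real.norm_eq_abs] at hξ_le
    linarith [hk.2.2 (by omega), hpow hlt, hpos (max i j)]
  · by_contra! hlt
    have hle_ξ := (dyadicRing_add_dyadicRing_subset_annulus (not_le.1 hfar) hξ).1
    rw [Real.norm_eq_abs] at hle_ξ
    linarith [hk.2.1, hpow hlt, hpos k]

theorem two_rpow_le_pairWeight {θ ρ : ℝ} (hθ : 0 ≤ θ) (hρ : ρ ≤ θ) {i j k : ℤ}
    (h : Interact i j k) :
    (2 : ℝ≥0∞) ^ (k * ρ) ≤
      2 ^ (6 * θ + 2 * |ρ|) * (pairWeight (θ - ρ) i j * (2 ^ (i * θ) * 2 ^ (j * θ))) := by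
  obtain ⟨hi, hj, hk, hkM, hfar⟩ := h
  have hk' : (-1 : ℝ) ≤ k := by exact_mod_cast hk
  have hkM' : (k : ℝ) ≤ (max i j : ℤ) + 2 := by exact_mod_cast hkM
  have hM : (-1 : ℝ) ≤ (max i j : ℤ) := by exact_mod_cast hi.trans (le_max_left i j)
  have habs := neg_le_abs ρ
  have habs' := le_abs_self ρ
  unfold pairWeight
  split_ifs with hclose
  · rw [one_mul, ← two_rpow_add, ← two_rpow_add]
    have hij : (2 * (max i j : ℤ) - 2 : ℝ) ≤ i + j := by
      rw [abs_le] at hclose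
      exact_mod_cast (by omega : 2 * max i j - 2 ≤ i + j)
    refine two_rpow_le_two_rpow ?_
    nlinarith [mul_le_mul_of_nonneg_left hρ (by linarith : 0 ≤ (k : ℝ) + 1)]
  · rw [← two_rpow_add, ← two_rpow_add, ← two_rpow_add]
    have hij : ((max i j : ℤ) - 1 : ℝ) ≤ i + j := by
      exact_mod_cast (by omega : max i j - 1 ≤ i + j)
    have hkM'' : ((max i j : ℤ) : ℝ) ≤ k + 2 := by exact_mod_cast hfar.resolve_left hclose
    have hdiff : (k - (max i j : ℤ)) * ρ ≤ 2 * |ρ| := by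
      refine (le_abs_self _).trans ?_
      rw [abs_mul]
      gcongr
      exact abs_le.2 ⟨by linarith, by linarith⟩
    refine two_rpow_le_two_rpow ?_
    nlinarith

namespace IsLittlewoodPaleyPair

theorem exists_besovNorm_top_le_tsum_pairWeight (h : IsLittlewoodPaleyPair χ φ) (m : ℝ≥0∞)
    [Fact (1 ≤ m)] {θ ρ : ℝ} (hθ : 0 ≤ θ) (hρ : ρ ≤ θ) :
    ∃ C : ℝ≥0, ∀ (P : ℤ × ℤ → 𝓢'(ℝ, ℂ)) (w : 𝓢'(ℝ, ℂ)),
      (∀ i j, HasSpectrumIn (dyadicRing i + dyadicRing j) (P (i, j))) → HasSum P w →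
      besovNorm χ φ ρ m ⊤ w ≤ C * ∑' x : ℤ × ℤ, pairWeight (θ - ρ) x.1 x.2 *
        (2 ^ (x.1 * θ) * 2 ^ (x.2 * θ) * distLpNorm m (P x)) := by
  obtain ⟨C, hC⟩ := h.exists_distLpNorm_dyadicBlock_le m
  refine ⟨2 ^ (6 * θ + 2 * |ρ|) * C, fun P w hP hw => essSup_le_of_ae_le _ (.of_forall fun k => ?_)⟩
  have hblock : HasSum (fun x => dyadicBlock χ φ k (P x)) (dyadicBlock χ φ k w) :=
    hw.mapL (TemperedDistribution.fourierMultiplierCLM ℂ (dyadicSymbol χ φ k))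
  have hterm (x : ℤ × ℤ) : (2 : ℝ≥0∞) ^ (k * ρ) * distLpNorm m (dyadicBlock χ φ k (P x)) ≤
      2 ^ (6 * θ + 2 * |ρ|) * C * (pairWeight (θ - ρ) x.1 x.2 *
        (2 ^ (x.1 * θ) * 2 ^ (x.2 * θ) * distLpNorm m (P x))) := by
    by_cases hx : Interact x.1 x.2 k
    · calc _ ≤ 2 ^ (6 * θ + 2 * |ρ|) * (pairWeight (θ - ρ) x.1 x.2 *
            (2 ^ (x.1 * θ) * 2 ^ (x.2 * θ))) * (C * distLpNorm m (P x)) :=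
            mul_le_mul' (two_rpow_le_pairWeight hθ hρ hx) (hC k (P x))
        _ = _ := by ring
    · rw [h.dyadicBlock_eq_zero (hP x.1 x.2) (disjoint_dyadicRing_add_dyadicRing hx),
        distLpNorm_zero, mul_zero]
      exact zero_le
  simp only [enorm_eq_self]
  rw [ENNReal.coe_mul, ENNReal.coe_rpow_of_ne_zero two_ne_zero, ENNReal.coe_ofNat,
    ← ENNReal.tsum_mul_left]
  refine (mul_le_mul_right (distLpNorm_le_tsum hblock) _).trans ?_
  rw [← ENNReal.tsum_mul_left]
  exact ENNReal.tsum_le_tsum hterm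

theorem exists_isDistProduct {q q' : ℝ≥0∞} [Fact (1 ≤ q)] [Fact (1 ≤ q')]
    [ENNReal.HolderTriple q q' m] (h : IsLittlewoodPaleyPair χ φ) {θ ρ : ℝ} (hθ : 0 ≤ θ)
    (hρ : ρ < θ) :
    ∃ C : ℝ≥0, ∀ u v : 𝓢'(ℝ, ℂ), MemBesov χ φ θ q 2 u → MemBesov χ φ θ q' 2 v →
      ∃ w : 𝓢'(ℝ, ℂ), IsDistProduct χ φ u v w ∧
        besovNorm χ φ ρ m ⊤ w ≤ C * besovNorm χ φ θ q 2 u * besovNorm χ φ θ q' 2 v := by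
  obtain ⟨C₁, hC₁⟩ := exists_tsum_pairWeight_mul_le two_pos
  obtain ⟨C₂, hC₂⟩ := exists_tsum_pairWeight_mul_le (sub_pos.2 hρ)
  obtain ⟨C₃, hC₃⟩ := h.exists_besovNorm_top_le_tsum_pairWeight m hθ hρ.le
  refine ⟨C₃ * C₂, fun u v hu hv => ?_⟩
  choose P hP_prod hP_norm hP_spec using fun i j => exists_isSmoothProduct (m := m)
    (distLpNorm_dyadicBlock_ne_top two_ne_zero hu i)
    (distLpNorm_dyadicBlock_ne_top two_ne_zero hv j) (h.hasSpectrumIn_dyadicBlock i u)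
    (dyadicRing_subset_closedBall i) (h.hasSpectrumIn_dyadicBlock j v)
  have hsum : ∑' x : ℤ × ℤ, pairWeight 2 x.1 x.2 * distLpNorm m (P x.1 x.2) ≠ ⊤ := by
    have hu₀ : besovNorm χ φ 0 q 2 u ≠ ⊤ :=
      ((besovNorm_le_of_le hθ u).trans_lt (ENNReal.mul_lt_top ENNReal.coe_lt_top hu)).ne
    have hv₀ : besovNorm χ φ 0 q' 2 v ≠ ⊤ :=
      ((besovNorm_le_of_le hθ v).trans_lt (ENNReal.mul_lt_top ENNReal.coe_lt_top hv)).ne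
    simp only [besovNorm, mul_zero, ENNReal.rpow_zero, one_mul] at hu₀ hv₀
    refine ne_top_of_le_ne_top (ENNReal.mul_ne_top ENNReal.coe_ne_top (ENNReal.mul_ne_top hu₀ hv₀))
      (le_trans ?_ (hC₁ _ _ (fun i hi => distLpNorm_dyadicBlock_of_lt hi u)
        fun j hj => distLpNorm_dyadicBlock_of_lt hj v))
    gcongr with x
    exact hP_norm x.1 x.2
  obtain ⟨w, hw⟩ := exists_hasSum_of_tsum_pairWeight_ne_top (P := fun x => P x.1 x.2) hP_spec hsum
  refine ⟨w, ⟨_, hP_prod, hw⟩, (hC₃ _ w hP_spec hw).trans ?_⟩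
  rw [ENNReal.coe_mul, mul_assoc, mul_assoc]
  refine mul_le_mul_right (le_trans ?_ (hC₂ _ _
    (fun i hi => by rw [distLpNorm_dyadicBlock_of_lt hi, mul_zero])
    fun j hj => by rw [distLpNorm_dyadicBlock_of_lt hj, mul_zero])) _
  refine ENNReal.tsum_le_tsum fun x => mul_le_mul_right ?_ _
  rw [mul_mul_mul_comm]
  exact mul_le_mul_right (hP_norm x.1 x.2) _

end IsLittlewoodPaleyPair

end Product

section BesovProduct

variable {χ φ : ℝ → ℝ} {p r : ℝ≥0∞} [Fact (1 ≤ p)]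

theorem IsLittlewoodPaleyPair.exists_isDistProduct_besovNorm_le (h : IsLittlewoodPaleyPair χ φ)
    {q m : ℝ≥0∞} [Fact (1 ≤ q)] [Fact (1 ≤ m)] [ENNReal.HolderTriple q q m] (hpq : p ≤ q)
    (hmp : m ≤ p) (hr : r ≠ 0) {σ θ ρ : ℝ} (hθ : 0 ≤ θ)
    (hθσ : θ < σ - (p⁻¹.toReal - q⁻¹.toReal) ∨ (θ = σ - (p⁻¹.toReal - q⁻¹.toReal) ∧ r ≤ 2))
    (hρ : ρ + (m⁻¹.toReal - p⁻¹.toReal) < θ) :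
    ∃ C : ℝ≥0, ∀ u v : 𝓢'(ℝ, ℂ), MemBesov χ φ σ p r u → MemBesov χ φ σ p r v →
      ∃ w : 𝓢'(ℝ, ℂ), IsDistProduct χ φ u v w ∧
        besovNorm χ φ ρ p 1 w ≤ C * besovNorm χ φ σ p r u * besovNorm χ φ σ p r v := by
  obtain ⟨ρ', hρ', hρ'θ⟩ := exists_between hρ
  obtain ⟨C₁, hC₁⟩ := h.exists_besovNorm_le hpq hr one_le_two hθσ
  obtain ⟨C₂, hC₂⟩ := h.exists_isDistProduct (q := q) (q' := q) (m := m) hθ hρ'θ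
  obtain ⟨C₃, hC₃⟩ := h.exists_besovNorm_le (τ := ρ) (σ := ρ') hmp ENNReal.top_ne_zero le_rfl
    (.inl (by linarith))
  have hmem {u : 𝓢'(ℝ, ℂ)} (hu : MemBesov χ φ σ p r u) : MemBesov χ φ θ q 2 u :=
    (hC₁ u).trans_lt (ENNReal.mul_lt_top ENNReal.coe_lt_top hu)
  refine ⟨C₃ * C₂ * C₁ * C₁, fun u v hu hv => ?_⟩
  obtain ⟨w, huv, hw⟩ := hC₂ u v (hmem hu) (hmem hv)
  refine ⟨w, huv, ?_⟩
  calc besovNorm χ φ ρ p 1 w ≤ C₃ * (C₂ * besovNorm χ φ θ q 2 u * besovNorm χ φ θ q 2 v) :=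
        (hC₃ w).trans (by gcongr)
    _ ≤ C₃ * (C₂ * (C₁ * besovNorm χ φ σ p r u) * (C₁ * besovNorm χ φ σ p r v)) := by
        gcongr
        exacts [hC₁ u, hC₁ v]
    _ = _ := by
        push_cast
        ring

theorem exists_holderTriple_self_max_two (p : ℝ≥0∞) [hp : Fact (1 ≤ p)] :
    ∃ (m : ℝ≥0∞) (_ : Fact (1 ≤ m)) (_ : ENNReal.HolderTriple (max p 2) (max p 2) m), m ≤ p ∧
      m⁻¹.toReal = 2 * (max p 2)⁻¹.toReal := by
  have hinv : (max p 2)⁻¹ ≤ 2⁻¹ := ENNReal.inv_le_inv.2 (le_max_right p 2)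
  have hinv_top : (max p 2)⁻¹ ≠ ⊤ := ne_top_of_le_ne_top (by simp) hinv
  refine ⟨((max p 2)⁻¹ + (max p 2)⁻¹)⁻¹, ⟨?_⟩, ⟨(inv_inv _).symm⟩, ?_, ?_⟩
  · rw [ENNReal.one_le_inv, ← ENNReal.inv_two_add_inv_two]
    gcongr
  · rw [ENNReal.inv_le_iff_inv_le]
    rcases le_total p 2 with h2 | h2
    · rw [max_eq_right h2, ENNReal.inv_two_add_inv_two]
      exact ENNReal.inv_le_one.2 hp.out
    · rw [max_eq_left h2]
      exact le_self_add
  · rw [inv_inv, ENNReal.toReal_add hinv_top hinv_top, two_mul]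

theorem toReal_inv_max_two (p : ℝ≥0∞) [hp : Fact (1 ≤ p)] :
    (max p 2)⁻¹.toReal = min p⁻¹.toReal (1 / 2) := by
  have hp_inv : p⁻¹ ≠ ⊤ := ENNReal.inv_ne_top.2 (zero_lt_one.trans_le hp.out).ne'
  rw [ENNReal.inv_strictAnti.antitone.map_max, ENNReal.toReal_min hp_inv (by simp)]
  simp

end BesovProduct

theorem lemma3p2_general (χ φ : ℝ → ℝ) (hχφ : IsLittlewoodPaleyPair χ φ)
    (s ρ : ℝ) (p r : ℝ≥0∞) [Fact (1 ≤ p)] (hr : r ≠ 0)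
    (hspr : max 2 (p⁻¹.toReal + 3 / 2) < s ∨ (s = max 2 (p⁻¹.toReal + 3 / 2) ∧ r ≤ 2))
    (hρ : ρ < s - 2 - min p⁻¹.toReal (1 / 2)) :
    ∃ C : ℝ≥0, ∀ u v : 𝓢'(ℝ, ℂ),
      MemBesov χ φ (s - 2) p r u → MemBesov χ φ (s - 2) p r v →
      ∃ w : 𝓢'(ℝ, ℂ), IsDistProduct χ φ u v w ∧
        besovNorm χ φ ρ p 1 w ≤
          C * besovNorm χ φ (s - 2) p r u * besovNorm χ φ (s - 2) p r v := by
  obtain ⟨m, _, _, hmp, hm⟩ := exists_holderTriple_self_max_two p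
  have : Fact (1 ≤ max p 2) := ⟨one_le_two.trans (le_max_right p 2)⟩
  have hq := toReal_inv_max_two p
  have hloss : max 2 (p⁻¹.toReal + 3 / 2) = 2 + (p⁻¹.toReal - (max p 2)⁻¹.toReal) := by
    rw [hq]
    rcases le_total p⁻¹.toReal (1 / 2) with hp | hp
    · rw [min_eq_left hp, max_eq_left (by linarith), sub_self, add_zero]
    · rw [min_eq_right hp, max_eq_right (by linarith)]
      ring
  obtain ⟨θ, hθ, hρθ, hθs⟩ : ∃ θ, 0 ≤ θ ∧ ρ + (m⁻¹.toReal - p⁻¹.toReal) < θ ∧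
      (θ < s - 2 - (p⁻¹.toReal - (max p 2)⁻¹.toReal) ∨
        (θ = s - 2 - (p⁻¹.toReal - (max p 2)⁻¹.toReal) ∧ r ≤ 2)) := by
    rw [hloss] at hspr
    rcases hspr with hs | ⟨rfl, hr2⟩
    · have hpos : 0 < s - 2 - (p⁻¹.toReal - (max p 2)⁻¹.toReal) := by linarith
      obtain ⟨θ, hθ, hθs⟩ := exists_between (max_lt hpos
        (by linarith : ρ + (m⁻¹.toReal - p⁻¹.toReal) < _))
      exact ⟨θ, (max_lt_iff.1 hθ).1.le, (max_lt_iff.1 hθ).2, .inl hθs⟩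
    · exact ⟨0, le_rfl, by linarith, .inr ⟨by ring, hr2⟩⟩
  exact hχφ.exists_isDistProduct_besovNorm_le (le_max_left p 2) hmp hr hθ hθs hρθ

theorem lemma3p2 (χ φ : ℝ → ℝ) (hχφ : IsLittlewoodPaleyPair χ φ)
    (s : ℝ) (p r : ℝ≥0∞) [Fact (1 ≤ p)] (hr : 1 ≤ r)
    (hspr : max 2 ((p⁻¹).toReal + 3 / 2) < s ∨ (s = 2 ∧ 2 ≤ p ∧ r ≤ 2)) :
    ∃ C : ℝ≥0, ∀ u v : 𝓢'(ℝ, ℂ),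
      MemBesov χ φ (s - 2) p r u → MemBesov χ φ (s - 2) p r v →
      ∃ w : 𝓢'(ℝ, ℂ), IsDistProduct χ φ u v w ∧
        besovNorm χ φ (s - 3) p r w ≤
          C * besovNorm χ φ (s - 2) p r u * besovNorm χ φ (s - 2) p r v := by
  have hendpoint (hp : 2 ≤ p) : max 2 (p⁻¹.toReal + 3 / 2) = 2 := by
    have hp_inv : p⁻¹.toReal ≤ 1 / 2 := by
      simpa using ENNReal.toReal_mono (by simp) (ENNReal.inv_le_inv.2 hp)
    exact max_eq_left (by linarith)
  obtain ⟨C, hC⟩ := lemma3p2_general χ φ hχφ s (s - 3) p r (zero_lt_one.trans_le hr).ne'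
    (hspr.imp_right fun ⟨hs, hp, hr2⟩ => ⟨hs.trans (hendpoint hp).symm, hr2⟩)
    (by linarith [min_le_right p⁻¹.toReal (1 / 2)])
  exact ⟨C, fun u v hu hv => (hC u v hu hv).imp fun w hw =>
    hw.imp_right (besovNorm_le_of_exponent_ge one_ne_zero hr w).trans⟩
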